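/- All manifolds are smooth, Hausdorff, finite-dimensional and without boundary, and all metrics and vector fields are smooth. Let $(N,\tilde g)$ be a Riemannian manifold with Levi-Civita connection $\tilde\nabla$, and let $v$ be a concurrent vector field on $N$, i.e. $\tilde\nabla_X v = X$ for every vector field $X$ on $N$. Let $(M,g)$ be a nonempty $n$-dimensional Riemannian manifold with $n\ge 1$, isometrically immersed in $(N,\tilde g)$ as a minimal submanifold, i.e. its mean curvature vector $H=\frac1n\operatorname{trace} h$ vanishes, where $h(X,Y)$ is the normal component of $\tilde\nabla_X Y$ for vector fields $X,Y$ tangent to $M$. Let $v^T$ be the tangential component of $v$ along $M$, let $R$ be the scalar curvature of $(M,g)$, and let $\rho\in\mathbb R$ be a constant such that $(M,g,v^T,\rho)$ is a Yamabe soliton, i.e. $$(R-\rho)\,g=\tfrac12\,\mathcal L_{v^T}g \quad\text{on } M.$$ Then $(M,g,v^T,\rho)$ is a gradient expanding Yamabe soliton, i.e. $v^T=\nabla f$ for some smooth function $f$ on $M$ and $\rho<0$; moreover $R=0$ everywhere on $M$ and $\rho=-1$. -/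

import Mathlib

open Bundle Manifold
open scoped ContDiff

noncomputable section

namespace YamabeSoliton

section Intrinsic

variable {E : Type*} [NormedAddCommGroup E] [NormedSpace ℝ E] [FiniteDimensional ℝ E]
  {H : Type*} [TopologicalSpace H] (I : ModelWithCorners ℝ E H)
  {M : Type*} [TopologicalSpace M] [ChartedSpace H M] [IsManifold I ∞ M]

/-- The vector field `X` is smooth at the point `x`. -/
def SmoothFieldAt (X : Π x : M, TangentSpace I x) (x : M) : Prop :=
  ContMDiffAt I (I.prod 𝓘(ℝ, E)) ∞ (fun y : M ↦ TotalSpace.mk' E y (X y)) x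

/-- The vector field `X` is smooth. -/
def SmoothField (X : Π x : M, TangentSpace I x) : Prop :=
  ContMDiff I (I.prod 𝓘(ℝ, E)) ∞ (fun y : M ↦ TotalSpace.mk' E y (X y))

/-- The local vector field through a tangent vector `u` at `x` which has constant coordinates in the
preferred chart at `x` (and vanishes outside the domain of that chart). It is smooth near `x`. -/
abbrev extendVector {x : M} (u : TangentSpace I x) : Π y : M, TangentSpace I y :=
  FiberBundle.extend E u

variable [RiemannianBundle (fun x : M ↦ TangentSpace I x)]

instance (x : M) : FiniteDimensional ℝ (TangentSpace I x) :=
  inferInstanceAs (FiniteDimensional ℝ E)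

/-- An orthonormal basis of the tangent space at `x`. -/
abbrev frame (x : M) : OrthonormalBasis
    (Fin (Module.finrank ℝ (TangentSpace I x))) ℝ (TangentSpace I x) :=
  stdOrthonormalBasis ℝ (TangentSpace I x)

/-- The right-hand side of the Koszul formula,
`X⟨Y, Z⟩ + Y⟨Z, X⟩ - Z⟨X, Y⟩ + ⟨[X, Y], Z⟩ - ⟨[Y, Z], X⟩ + ⟨[Z, X], Y⟩`, at the point `x`. -/
def koszul (X Y Z : Π x : M, TangentSpace I x) (x : M) : ℝ :=
  mvfderiv I (fun y ↦ inner ℝ (Y y) (Z y)) x (X x)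
    + mvfderiv I (fun y ↦ inner ℝ (Z y) (X y)) x (Y x)
    - mvfderiv I (fun y ↦ inner ℝ (X y) (Y y)) x (Z x)
    + inner ℝ (VectorField.mlieBracket I X Y x) (Z x)
    - inner ℝ (VectorField.mlieBracket I Y Z x) (X x)
    + inner ℝ (VectorField.mlieBracket I Z X x) (Y x)

/-- The Levi-Civita connection `∇_X Y` of the Riemannian metric: the vector field determined by
`2 ⟨∇_X Y, Z⟩ = koszul X Y Z`, written out in an orthonormal basis of each tangent space. -/
def leviCivita (X Y : Π x : M, TangentSpace I x) (x : M) : TangentSpace I x :=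
  ∑ i, ((1 / 2 : ℝ) * koszul I X Y (extendVector I (frame I x i)) x) • frame I x i

/-- The Riemann curvature `Rm(X, Y)Z = ∇_X ∇_Y Z - ∇_Y ∇_X Z - ∇_[X,Y] Z`. -/
def riemannCurvature (X Y Z : Π x : M, TangentSpace I x) (x : M) : TangentSpace I x :=
  leviCivita I X (leviCivita I Y Z) x - leviCivita I Y (leviCivita I X Z) x
    - leviCivita I (VectorField.mlieBracket I X Y) Z x

/-- The scalar curvature `R = ∑ i j, ⟨Rm(e_i, e_j) e_j, e_i⟩`, for an orthonormal basis `e` of the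
tangent space (the unit `n`-sphere has `R = n (n - 1)`). -/
def scalarCurvature (x : M) : ℝ :=
  ∑ i, ∑ j, inner ℝ
    (riemannCurvature I (extendVector I (frame I x i)) (extendVector I (frame I x j))
      (extendVector I (frame I x j)) x)
    (frame I x i)

/-- The Lie derivative of the metric,
`(L_V g)(X, Y) = V⟨X, Y⟩ - ⟨[V, X], Y⟩ - ⟨X, [V, Y]⟩`, at the point `x`. -/
def lieDerivMetric (V X Y : Π x : M, TangentSpace I x) (x : M) : ℝ :=
  mvfderiv I (fun y ↦ inner ℝ (X y) (Y y)) x (V x)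
    - inner ℝ (VectorField.mlieBracket I V X x) (Y x)
    - inner ℝ (X x) (VectorField.mlieBracket I V Y x)

/-- `(M, g, V, ρ)` is a Yamabe soliton: `V` is a smooth vector field, `ρ` a constant, and
`(R - ρ) g = (1/2) L_V g`. -/
structure IsYamabeSoliton (V : Π x : M, TangentSpace I x) (ρ : ℝ) : Prop where
  smooth : SmoothField I V
  equation : ∀ (x : M) (X Y : Π x : M, TangentSpace I x),
    SmoothFieldAt I X x → SmoothFieldAt I Y x →
    (scalarCurvature I x - ρ) * inner ℝ (X x) (Y x) = (1 / 2 : ℝ) * lieDerivMetric I V X Y x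

/-- `V` is the gradient of the function `f`. -/
def IsGradientOf (V : Π x : M, TangentSpace I x) (f : M → ℝ) : Prop :=
  ∀ (x : M) (u : TangentSpace I x), inner ℝ (V x) u = mvfderiv I f x u

/-- A gradient Yamabe soliton: a Yamabe soliton whose vector field is the gradient of a smooth
function. -/
def IsGradientYamabeSoliton (V : Π x : M, TangentSpace I x) (ρ : ℝ) : Prop :=
  IsYamabeSoliton I V ρ ∧ ∃ f : M → ℝ, ContMDiff I 𝓘(ℝ, ℝ) ∞ f ∧ IsGradientOf I V f

/-- A gradient expanding Yamabe soliton: `ρ < 0`. -/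
def IsGradientExpandingYamabeSoliton (V : Π x : M, TangentSpace I x) (ρ : ℝ) : Prop :=
  IsGradientYamabeSoliton I V ρ ∧ ρ < 0

/-- A concurrent vector field: `∇_X v = X` for every vector field `X`. -/
structure IsConcurrent (v : Π x : M, TangentSpace I x) : Prop where
  smooth : SmoothField I v
  equation : ∀ (x : M) (X : Π x : M, TangentSpace I x),
    SmoothFieldAt I X x → leviCivita I X v x = X x

end Intrinsic

section Submanifold

variable {E : Type*} [NormedAddCommGroup E] [NormedSpace ℝ E] [FiniteDimensional ℝ E]
  {H : Type*} [TopologicalSpace H] (I : ModelWithCorners ℝ E H)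
  {M : Type*} [TopologicalSpace M] [ChartedSpace H M] [IsManifold I ∞ M]
  [RiemannianBundle (fun x : M ↦ TangentSpace I x)]
  {F : Type*} [NormedAddCommGroup F] [NormedSpace ℝ F] [FiniteDimensional ℝ F]
  {G : Type*} [TopologicalSpace G] (J : ModelWithCorners ℝ F G)
  {N : Type*} [TopologicalSpace N] [ChartedSpace G N] [IsManifold J ∞ N]
  [RiemannianBundle (fun y : N ↦ TangentSpace J y)]

/-- `ι : M → N` is a smooth isometric immersion, i.e. it makes `M` with its metric an (immersed)
Riemannian submanifold of `N`. (Injectivity of the differential follows from the isometry.) -/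
structure IsIsometricImmersion (ι : M → N) : Prop where
  smooth : ContMDiff I J ∞ ι
  isometric : ∀ (x : M) (u w : TangentSpace I x),
    inner ℝ (mfderiv I J ι x u) (mfderiv I J ι x w) = inner ℝ u w

/-- The tangential component of a vector `w` of `N` at `ι x`, as a tangent vector of `M`: the vector
`u` such that `dι u` is the orthogonal projection of `w` to the image of `dι`. -/
def tangentialPart (ι : M → N) (x : M) (w : TangentSpace J (ι x)) : TangentSpace I x :=
  ∑ i, inner ℝ w (mfderiv I J ι x (frame I x i)) • frame I x i

/-- The normal component of a vector `w` of `N` at `ι x`. -/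
def normalPart (ι : M → N) (x : M) (w : TangentSpace J (ι x)) : TangentSpace J (ι x) :=
  w - mfderiv I J ι x (tangentialPart I J ι x w)

/-- The covariant derivative `∇̃_X W` (Levi-Civita connection of `N`) of a vector field `W` of `N`
along `ι`, in the direction of a vector field `X` of `M`. With `W = ∑ a, W^a E_a` in the coordinate
frame of the preferred chart of `N` at `ι x`, it is
`∑ a, X(W^a) E_a + ∑ a, W^a ∇̃_{dι X} E_a` at `x`. -/
def covDerivAlong (ι : M → N) (X : Π x : M, TangentSpace I x) (W : Π x : M, TangentSpace J (ι x))
    (x : M) : TangentSpace J (ι x) :=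
  (trivializationAt F (TangentSpace J : N → Type _) (ι x)).symm (ι x)
      (mvfderiv I (fun y : M ↦ (trivializationAt F (TangentSpace J : N → Type _) (ι x)
        (TotalSpace.mk' F (ι y) (W y))).2) x (X x))
    + leviCivita J (extendVector J (mfderiv I J ι x (X x))) (extendVector J (W x)) (ι x)

/-- The second fundamental form `h(X, Y)`: the normal component of `∇̃_X Y`. -/
def secondFundamentalForm (ι : M → N) (X Y : Π x : M, TangentSpace I x) (x : M) :
    TangentSpace J (ι x) :=
  normalPart I J ι x (covDerivAlong I J ι X (fun y ↦ mfderiv I J ι y (Y y)) x)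

/-- The mean curvature vector `H = (1/n) trace h`, where `n = dim M`. -/
def meanCurvature (ι : M → N) (x : M) : TangentSpace J (ι x) :=
  (1 / (Module.finrank ℝ E : ℝ)) • ∑ i, secondFundamentalForm I J ι
    (extendVector I (frame I x i)) (extendVector I (frame I x i)) x

/-- A minimal submanifold: the mean curvature vector vanishes. -/
def IsMinimal (ι : M → N) : Prop := ∀ x : M, meanCurvature I J ι x = 0

end Submanifold

end YamabeSoliton

end

noncomputable section

set_option linter.unusedSectionVars false

namespace YamabeSoliton

open Filter Topology VectorField

section Calculus

variable {E : Type*} [NormedAddCommGroup E] [NormedSpace ℝ E] [FiniteDimensional ℝ E]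
  {H : Type*} [TopologicalSpace H] {I : ModelWithCorners ℝ E H}
  {M : Type*} [TopologicalSpace M] [ChartedSpace H M] [IsManifold I ∞ M]

/-- The function `f` is smooth at all points near `x`. -/
def SmoothFunNear (I : ModelWithCorners ℝ E H) (f : M → ℝ) (x : M) : Prop :=
  ∀ᶠ y in 𝓝 x, ContMDiffAt I 𝓘(ℝ, ℝ) ∞ f y

/-- The vector field `X` is smooth at all points near `x`. -/
def SmoothFieldNear (I : ModelWithCorners ℝ E H) [IsManifold I ∞ M]
    (X : Π x : M, TangentSpace I x) (x : M) : Prop :=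
  ∀ᶠ y in 𝓝 x, SmoothFieldAt I X y

variable {f g : M → ℝ} {X Y Z V : Π x : M, TangentSpace I x} {x : M}

lemma SmoothFieldAt.mdifferentiableAt (h : SmoothFieldAt I X x) : MDiffAt (T% X) x :=
  ContMDiffAt.mdifferentiableAt h (by simp)

lemma SmoothFieldAt.congr (h : SmoothFieldAt I X x) (hXY : Y =ᶠ[𝓝 x] X) :
    SmoothFieldAt I Y x := by
  refine ContMDiffAt.congr_of_eventuallyEq h ?_
  filter_upwards [hXY] with y hy
  rw [hy]

lemma SmoothFieldNear.self (h : SmoothFieldNear I X x) : SmoothFieldAt I X x :=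
  h.self_of_nhds

lemma SmoothFieldNear.mdifferentiableAt (h : SmoothFieldNear I X x) : MDiffAt (T% X) x :=
  h.self.mdifferentiableAt

lemma SmoothFieldNear.eventually (h : SmoothFieldNear I X x) :
    ∀ᶠ y in 𝓝 x, SmoothFieldNear I X y := eventually_eventually_nhds.2 h

lemma SmoothFieldNear.congr (h : SmoothFieldNear I X x) (hXY : Y =ᶠ[𝓝 x] X) :
    SmoothFieldNear I Y x := by
  filter_upwards [h, hXY.eventuallyEq_nhds] with y hy hy' using hy.congr hy'

lemma SmoothField.near (h : SmoothField I X) : SmoothFieldNear I X x :=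
  Eventually.of_forall fun y ↦ h y

lemma SmoothFunNear.self (h : SmoothFunNear I f x) : ContMDiffAt I 𝓘(ℝ, ℝ) ∞ f x :=
  h.self_of_nhds

lemma SmoothFunNear.mdifferentiableAt (h : SmoothFunNear I f x) : MDiffAt f x :=
  h.self.mdifferentiableAt (by simp)

lemma SmoothFunNear.eventually (h : SmoothFunNear I f x) :
    ∀ᶠ y in 𝓝 x, SmoothFunNear I f y := eventually_eventually_nhds.2 h

lemma SmoothFunNear.congr (h : SmoothFunNear I f x) (hfg : g =ᶠ[𝓝 x] f) :
    SmoothFunNear I g x := by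
  filter_upwards [h, hfg.eventuallyEq_nhds] with y hy hy' using hy.congr_of_eventuallyEq hy'

lemma smoothFunNear_const (c : ℝ) : SmoothFunNear I (fun _ : M ↦ c) x :=
  Eventually.of_forall fun _ ↦ contMDiffAt_const

lemma SmoothFunNear.add (hf : SmoothFunNear I f x) (hg : SmoothFunNear I g x) :
    SmoothFunNear I (f + g) x := by
  filter_upwards [hf, hg] with y h h' using h.add h'

lemma SmoothFunNear.sub (hf : SmoothFunNear I f x) (hg : SmoothFunNear I g x) :
    SmoothFunNear I (f - g) x := by
  filter_upwards [hf, hg] with y h h' using h.sub h'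

lemma SmoothFunNear.mul (hf : SmoothFunNear I f x) (hg : SmoothFunNear I g x) :
    SmoothFunNear I (f * g) x := by
  filter_upwards [hf, hg] with y h h' using h.mul h'

lemma SmoothFieldNear.sub (hX : SmoothFieldNear I X x) (hY : SmoothFieldNear I Y x) :
    SmoothFieldNear I (X - Y) x := by
  filter_upwards [hX, hY] with y h h' using ContMDiffAt.sub_section h h'

lemma SmoothFieldNear.smul (hf : SmoothFunNear I f x) (hX : SmoothFieldNear I X x) :
    SmoothFieldNear I (f • X) x := by
  filter_upwards [hf, hX] with y h h' using ContMDiffAt.smul_section h h'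

lemma SmoothFieldNear.sum {κ : Type*} {s : Finset κ} {X : κ → Π x : M, TangentSpace I x}
    (hX : ∀ i, SmoothFieldNear I (X i) x) :
    SmoothFieldNear I (fun y ↦ ∑ i ∈ s, X i y) x := by
  have : ∀ᶠ y in 𝓝 x, ∀ i ∈ s, SmoothFieldAt I (X i) y :=
    (Finset.eventually_all s).2 fun i _ ↦ hX i
  filter_upwards [this] with y h using ContMDiffAt.sum_section (t := X) h

lemma smoothFieldNear_extendVector (u : TangentSpace I x) :
    SmoothFieldNear I (extendVector I u) x := by
  obtain ⟨s, hs, h⟩ := FiberBundle.exists_contMDiffOn_extend (k := ∞) I E u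
  filter_upwards [eventually_mem_nhds_iff.2 hs] with y hy using h.contMDiffAt hy

lemma extendVector_self (u : TangentSpace I x) : extendVector I u x = u := by
  simp

lemma isManifold_minSmoothness_three : IsManifold I (minSmoothness ℝ 3) M := by
  rw [minSmoothness_of_isRCLikeNormedField]
  infer_instance

lemma isManifold_minSmoothness_two : IsManifold I (minSmoothness ℝ 2) M := by
  rw [minSmoothness_of_isRCLikeNormedField]
  infer_instance

lemma mlieBracket_mlieBracket (hX : SmoothFieldAt I X x) (hY : SmoothFieldAt I Y x)
    (hZ : SmoothFieldAt I Z x) :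
    mlieBracket I X (mlieBracket I Y Z) x =
      mlieBracket I (mlieBracket I X Y) Z x + mlieBracket I Y (mlieBracket I X Z) x := by
  have : CompleteSpace E := FiniteDimensional.complete ℝ E
  have : IsManifold I (minSmoothness ℝ 3) M := isManifold_minSmoothness_three
  have h2 : minSmoothness ℝ 2 ≤ ∞ := by
    rw [minSmoothness_of_isRCLikeNormedField]
    exact ENat.LEInfty.out
  exact leibniz_identity_mlieBracket_apply (ContMDiffAt.of_le hX h2) (ContMDiffAt.of_le hY h2)
    (ContMDiffAt.of_le hZ h2)

lemma SmoothFieldNear.lieBracket (hX : SmoothFieldNear I X x) (hY : SmoothFieldNear I Y x) :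
    SmoothFieldNear I (mlieBracket I X Y) x := by
  have : CompleteSpace E := FiniteDimensional.complete ℝ E
  have : IsManifold I (minSmoothness ℝ 2) M := isManifold_minSmoothness_two
  have : IsManifold I ((⊤ : ℕ∞) + 1 : ℕ∞ω) M := inferInstanceAs (IsManifold I ∞ M)
  filter_upwards [hX, hY] with y h h'
  exact ContMDiffAt.mlieBracket_vectorField (m := ⊤) (n := ⊤) h h' (by simp)

lemma mlieBracket_funSmul (hf : SmoothFunNear I f x) (hY : SmoothFieldNear I Y x) :
    mlieBracket I X (f • Y) =ᶠ[𝓝 x]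
      (fun y ↦ mvfderiv I f y (X y)) • Y + f • mlieBracket I X Y := by
  have : CompleteSpace E := FiniteDimensional.complete ℝ E
  filter_upwards [hf.eventually, hY] with y h h'
  exact mlieBracket_smul_right h.mdifferentiableAt h'.mdifferentiableAt

lemma mvfderiv_congr {F : Type*} [NormedAddCommGroup F] [NormedSpace ℝ F] {f g : M → F}
    (h : f =ᶠ[𝓝 x] g) : mvfderiv I f x = mvfderiv I g x := by
  ext u
  change (NormedSpace.fromTangentSpace (f x)) (mfderiv I 𝓘(ℝ, F) f x u)
    = (NormedSpace.fromTangentSpace (g x)) (mfderiv I 𝓘(ℝ, F) g x u)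
  rw [h.mfderiv_eq]
  rfl

end Calculus

section Metric

variable {E : Type*} [NormedAddCommGroup E] [NormedSpace ℝ E] [FiniteDimensional ℝ E]
  {H : Type*} [TopologicalSpace H] {I : ModelWithCorners ℝ E H}
  {M : Type*} [TopologicalSpace M] [ChartedSpace H M] [IsManifold I ∞ M]
  [RiemannianBundle (fun x : M ↦ TangentSpace I x)]
  [IsContMDiffRiemannianBundle I ∞ E (fun x : M ↦ TangentSpace I x)]
  {f g : M → ℝ} {X Y Z V : Π x : M, TangentSpace I x} {x : M}

lemma SmoothFieldAt.metric (hX : SmoothFieldAt I X x) (hY : SmoothFieldAt I Y x) :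
    ContMDiffAt I 𝓘(ℝ, ℝ) ∞ (fun y ↦ inner ℝ (X y) (Y y)) x :=
  ContMDiffAt.inner_bundle (E := fun x : M ↦ TangentSpace I x) hX hY

lemma SmoothFieldNear.metric (hX : SmoothFieldNear I X x) (hY : SmoothFieldNear I Y x) :
    SmoothFunNear I (fun y ↦ inner ℝ (X y) (Y y)) x := by
  filter_upwards [hX, hY] with y h h' using h.metric h'

lemma exists_smoothFieldNear_ne_zero [Nontrivial E] (x : M) :
    ∃ Z : Π x : M, TangentSpace I x, SmoothFieldNear I Z x ∧ ∀ᶠ y in 𝓝 x, Z y ≠ 0 := by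
  obtain ⟨u, hu⟩ := exists_ne (0 : E)
  let u' : TangentSpace I x := u
  have hZ := smoothFieldNear_extendVector u'
  refine ⟨_, hZ, ?_⟩
  have hu' : inner ℝ (extendVector I u' x) (extendVector I u' x) ≠ 0 := by
    rw [extendVector_self]
    exact inner_self_ne_zero.2 hu
  have h := (hZ.metric hZ).self.continuousAt.eventually_ne hu'
  filter_upwards [h] with y hy
  exact inner_self_ne_zero.1 hy

lemma SmoothFunNear.derivAlong (hf : SmoothFunNear I f x) (hX : SmoothFieldNear I X x) :
    SmoothFunNear I (fun y ↦ mvfderiv I f y (X y)) x := by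
  cases subsingleton_or_nontrivial E
  · refine (smoothFunNear_const 0).congr (Eventually.of_forall fun y ↦ ?_)
    have : X y = 0 := Subsingleton.elim (α := E) _ _
    simp [this]
  obtain ⟨Z, hZ, hZ0⟩ := exists_smoothFieldNear_ne_zero (I := I) x
  have key : (fun y ↦ mvfderiv I f y (X y)) =ᶠ[𝓝 x] fun y ↦
      inner ℝ ((mlieBracket I X (f • Z) - f • mlieBracket I X Z) y) (Z y) /
        inner ℝ (Z y) (Z y) := by
    filter_upwards [mlieBracket_funSmul (X := X) hf hZ, hZ0] with y hy hy0
    have : inner ℝ (Z y) (Z y) ≠ 0 := inner_self_ne_zero.2 hy0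
    rw [Pi.sub_apply, hy, eq_div_iff this]
    simp [inner_smul_left]
  refine SmoothFunNear.congr ?_ key
  filter_upwards [((hX.lieBracket (hZ.smul hf)).sub ((hX.lieBracket hZ).smul hf)).metric hZ,
    hZ.metric hZ, hZ0] with y h1 h2 h3
  exact h1.div₀ h2 (inner_self_ne_zero.2 h3)

lemma mvfderiv_mvfderiv_sub (hf : SmoothFunNear I f x) (hX : SmoothFieldNear I X x)
    (hY : SmoothFieldNear I Y x) :
    mvfderiv I (fun y ↦ mvfderiv I f y (Y y)) x (X x)
      - mvfderiv I (fun y ↦ mvfderiv I f y (X y)) x (Y x)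
      = mvfderiv I f x (mlieBracket I X Y x) := by
  have : CompleteSpace E := FiniteDimensional.complete ℝ E
  cases subsingleton_or_nontrivial E
  · have (Z : Π x : M, TangentSpace I x) : Z x = 0 := Subsingleton.elim (α := E) _ _
    simp [this]
  obtain ⟨Z, hZ, hZ0⟩ := exists_smoothFieldNear_ne_zero (I := I) x
  have jac := mlieBracket_mlieBracket hX.self hY.self (hZ.smul hf).self
  have jac' := mlieBracket_mlieBracket hX.self hY.self hZ.self
  have expand {A B : Π x : M, TangentSpace I x} (hB : SmoothFieldNear I B x) :
      mlieBracket I A (mlieBracket I B (f • Z)) x =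
        mvfderiv I (fun y ↦ mvfderiv I f y (B y)) x (A x) • Z x
          + mvfderiv I f x (B x) • mlieBracket I A Z x
          + mvfderiv I f x (A x) • mlieBracket I B Z x
          + f x • mlieBracket I A (mlieBracket I B Z) x := by
    rw [(EventuallyEq.refl _ A).mlieBracket_vectorField_eq (mlieBracket_funSmul hf hZ),
      mlieBracket_add_right (hZ.smul (hf.derivAlong hB)).mdifferentiableAt
        ((hB.lieBracket hZ).smul hf).mdifferentiableAt,
      mlieBracket_smul_right (hf.derivAlong hB).mdifferentiableAt hZ.mdifferentiableAt,
      mlieBracket_smul_right hf.mdifferentiableAt (hB.lieBracket hZ).mdifferentiableAt]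
    abel
  rw [expand hY, expand hX, (mlieBracket_funSmul hf hZ).self_of_nhds, jac'] at jac
  simp only [Pi.add_apply, Pi.smul_apply', smul_add] at jac
  have h : (mvfderiv I (fun y ↦ mvfderiv I f y (Y y)) x (X x)
      - mvfderiv I (fun y ↦ mvfderiv I f y (X y)) x (Y x)
      - mvfderiv I f x (mlieBracket I X Y x)) • Z x = 0 := by
    rw [sub_smul, sub_smul, sub_sub, sub_eq_zero]
    have := sub_eq_zero.2 jac
    rw [← sub_eq_zero, ← this]
    abel
  have := (smul_eq_zero.1 h).resolve_right hZ0.self_of_nhds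
  linarith

end Metric

section LeviCivita

variable {E : Type*} [NormedAddCommGroup E] [NormedSpace ℝ E] [FiniteDimensional ℝ E]
  {H : Type*} [TopologicalSpace H] {I : ModelWithCorners ℝ E H}
  {M : Type*} [TopologicalSpace M] [ChartedSpace H M] [IsManifold I ∞ M]
  [RiemannianBundle (fun x : M ↦ TangentSpace I x)]
  [IsContMDiffRiemannianBundle I ∞ E (fun x : M ↦ TangentSpace I x)]
  {f g : M → ℝ} {X X' Y Y' Z Z' V : Π x : M, TangentSpace I x} {x : M}

lemma mdifferentiableAt_metric (hX : MDiffAt (T% X) x) (hY : MDiffAt (T% Y) x) :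
    MDiffAt (fun y ↦ inner ℝ (X y) (Y y)) x :=
  MDifferentiableAt.inner_bundle (E := fun x : M ↦ TangentSpace I x) hX hY

lemma mvfderiv_metric_add (hX : MDiffAt (T% X) x) (hY : MDiffAt (T% Y) x)
    (hZ : MDiffAt (T% Z) x) :
    mvfderiv I (fun y ↦ inner ℝ ((X + Y) y) (Z y)) x =
      mvfderiv I (fun y ↦ inner ℝ (X y) (Z y)) x + mvfderiv I (fun y ↦ inner ℝ (Y y) (Z y)) x := by
  rw [← mvfderiv_add (mdifferentiableAt_metric hX hZ) (mdifferentiableAt_metric hY hZ)]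
  refine congrArg (fun h ↦ mvfderiv I h x) (funext fun y ↦ ?_)
  exact inner_add_left _ _ _

lemma mvfderiv_metric_smul (hf : MDiffAt f x) (hX : MDiffAt (T% X) x) (hY : MDiffAt (T% Y) x) :
    mvfderiv I (fun y ↦ inner ℝ ((f • X) y) (Y y)) x =
      f x • mvfderiv I (fun y ↦ inner ℝ (X y) (Y y)) x
        + (inner ℝ (X x) (Y x) : ℝ) • mvfderiv I f x := by
  rw [← mvfderiv_mul hf (mdifferentiableAt_metric hX hY)]
  refine congrArg (fun h ↦ mvfderiv I h x) (funext fun y ↦ ?_)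
  exact real_inner_smul_left _ _ _

lemma metric_comm (X Y : Π x : M, TangentSpace I x) :
    (fun y ↦ (inner ℝ (X y) (Y y) : ℝ)) = fun y ↦ inner ℝ (Y y) (X y) :=
  funext fun _ ↦ real_inner_comm _ _

lemma tensorialAt_koszul (hX : MDiffAt (T% X) x) (hY : MDiffAt (T% Y) x) :
    TensorialAt I E (fun Z ↦ koszul I X Y Z x) x where
  smul {f Z} hf hZ := by
    have : CompleteSpace E := FiniteDimensional.complete ℝ E
    unfold koszul
    rw [metric_comm Y (f • Z), mvfderiv_metric_smul hf hZ hY, mvfderiv_metric_smul hf hZ hX,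
      mlieBracket_smul_right hf hZ, mlieBracket_smul_left hf hZ, metric_comm Z Y]
    simp only [add_apply, smul_apply, Pi.smul_apply',
      map_smul, inner_add_left, real_inner_smul_left, real_inner_smul_right, smul_eq_mul]
    ring
  add {Z Z'} hZ hZ' := by
    have : CompleteSpace E := FiniteDimensional.complete ℝ E
    unfold koszul
    rw [metric_comm Y (Z + Z'), mvfderiv_metric_add hZ hZ' hY, mvfderiv_metric_add hZ hZ' hX,
      mlieBracket_add_right hZ hZ', mlieBracket_add_left hZ hZ', metric_comm Z Y, metric_comm Z' Y]
    simp only [add_apply, Pi.add_apply,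
      map_add, inner_add_left, inner_add_right]
    ring

lemma inner_leviCivita (hX : MDiffAt (T% X) x) (hY : MDiffAt (T% Y) x) (hZ : MDiffAt (T% Z) x) :
    inner ℝ (leviCivita I X Y x) (Z x) = 1 / 2 * koszul I X Y Z x := by
  have ht := tensorialAt_koszul hX hY
  set Φ := TensorialAt.mkHom _ x ht
  have hZΦ : koszul I X Y Z x = Φ (Z x) := (ht.mkHom_apply hZ).symm
  have hext (u : TangentSpace I x) : koszul I X Y (extendVector I u) x = Φ u := rfl
  rw [hZΦ]
  conv_rhs => rw [← (frame I x).sum_repr' (Z x)]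
  unfold leviCivita
  simp only [hext, sum_inner, map_sum, map_smul, real_inner_smul_left, smul_eq_mul, Finset.mul_sum]
  exact Finset.sum_congr rfl fun i _ ↦ by ring

lemma eq_of_inner_field {u w : TangentSpace I x}
    (h : ∀ Z : Π x : M, TangentSpace I x, SmoothFieldNear I Z x →
      inner ℝ u (Z x) = (inner ℝ w (Z x) : ℝ)) : u = w := by
  refine ext_inner_right ℝ fun z ↦ ?_
  have := h (extendVector I z) (smoothFieldNear_extendVector z)
  rwa [extendVector_self] at this

lemma koszul_add_left (hX : MDiffAt (T% X) x) (hX' : MDiffAt (T% X') x) (hY : MDiffAt (T% Y) x)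
    (hZ : MDiffAt (T% Z) x) :
    koszul I (X + X') Y Z x = koszul I X Y Z x + koszul I X' Y Z x := by
  have : CompleteSpace E := FiniteDimensional.complete ℝ E
  unfold koszul
  rw [metric_comm Z (X + X'), mvfderiv_metric_add hX hX' hZ, mvfderiv_metric_add hX hX' hY,
    mlieBracket_add_right hX hX', mlieBracket_add_left hX hX', metric_comm Z X, metric_comm Z X']
  simp only [add_apply, Pi.add_apply, map_add, inner_add_left, inner_add_right]
  ring

lemma koszul_smul_left (hf : MDiffAt f x) (hX : MDiffAt (T% X) x) (hY : MDiffAt (T% Y) x)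
    (hZ : MDiffAt (T% Z) x) :
    koszul I (f • X) Y Z x = f x * koszul I X Y Z x := by
  have : CompleteSpace E := FiniteDimensional.complete ℝ E
  unfold koszul
  rw [metric_comm Z (f • X), mvfderiv_metric_smul hf hX hZ, mvfderiv_metric_smul hf hX hY,
    mlieBracket_smul_right hf hX, mlieBracket_smul_left hf hX, metric_comm Z X]
  simp only [add_apply, smul_apply, Pi.smul_apply',
    map_smul, inner_add_left, real_inner_smul_left, real_inner_smul_right, smul_eq_mul]
  ring

lemma koszul_add_right (hY : MDiffAt (T% Y) x) (hY' : MDiffAt (T% Y') x) (hX : MDiffAt (T% X) x)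
    (hZ : MDiffAt (T% Z) x) :
    koszul I X (Y + Y') Z x = koszul I X Y Z x + koszul I X Y' Z x := by
  have : CompleteSpace E := FiniteDimensional.complete ℝ E
  unfold koszul
  rw [metric_comm X (Y + Y'), mvfderiv_metric_add hY hY' hZ, mvfderiv_metric_add hY hY' hX,
    mlieBracket_add_right hY hY', mlieBracket_add_left hY hY', metric_comm X Y, metric_comm X Y']
  simp only [add_apply, Pi.add_apply, map_add, inner_add_left, inner_add_right]
  ring

lemma koszul_smul_right (hf : MDiffAt f x) (hY : MDiffAt (T% Y) x) (hX : MDiffAt (T% X) x)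
    (hZ : MDiffAt (T% Z) x) :
    koszul I X (f • Y) Z x =
      2 * mvfderiv I f x (X x) * inner ℝ (Y x) (Z x) + f x * koszul I X Y Z x := by
  have : CompleteSpace E := FiniteDimensional.complete ℝ E
  unfold koszul
  rw [metric_comm X (f • Y), mvfderiv_metric_smul hf hY hZ, mvfderiv_metric_smul hf hY hX,
    mlieBracket_smul_right hf hY, mlieBracket_smul_left hf hY, metric_comm X Y]
  simp only [add_apply, smul_apply, Pi.smul_apply',
    map_smul, inner_add_left, real_inner_smul_left, real_inner_smul_right, smul_eq_mul]
  ring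

lemma koszul_congr (hX : X =ᶠ[𝓝 x] X') (hY : Y =ᶠ[𝓝 x] Y') :
    koszul I X Y Z x = koszul I X' Y' Z x := by
  unfold koszul
  rw [hX.mlieBracket_vectorField_eq hY, hY.mlieBracket_vectorField_eq (EventuallyEq.refl _ Z),
    (EventuallyEq.refl _ Z).mlieBracket_vectorField_eq hX, hX.self_of_nhds, hY.self_of_nhds,
    mvfderiv_congr (f := fun y ↦ inner ℝ (Y y) (Z y)) (g := fun y ↦ inner ℝ (Y' y) (Z y))
      (hY.mono fun y h ↦ by simp only [h]),
    mvfderiv_congr (f := fun y ↦ inner ℝ (Z y) (X y)) (g := fun y ↦ inner ℝ (Z y) (X' y))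
      (hX.mono fun y h ↦ by simp only [h]),
    mvfderiv_congr (f := fun y ↦ inner ℝ (X y) (Y y)) (g := fun y ↦ inner ℝ (X' y) (Y' y))
      ((hX.and hY).mono fun y h ↦ by simp only [h.1, h.2])]

lemma leviCivita_congr (hX : X =ᶠ[𝓝 x] X') (hY : Y =ᶠ[𝓝 x] Y') :
    leviCivita I X Y x = leviCivita I X' Y' x := by
  unfold leviCivita
  exact Finset.sum_congr rfl fun i _ ↦ by rw [koszul_congr hX hY]

lemma leviCivita_eventuallyEq (hX : X =ᶠ[𝓝 x] X') (hY : Y =ᶠ[𝓝 x] Y') :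
    leviCivita I X Y =ᶠ[𝓝 x] leviCivita I X' Y' := by
  filter_upwards [hX.eventuallyEq_nhds, hY.eventuallyEq_nhds] with y h h'
    using leviCivita_congr h h'

lemma leviCivita_add_left (hX : MDiffAt (T% X) x) (hX' : MDiffAt (T% X') x)
    (hY : MDiffAt (T% Y) x) :
    leviCivita I (X + X') Y x = leviCivita I X Y x + leviCivita I X' Y x := by
  refine eq_of_inner_field fun Z hZ ↦ ?_
  rw [inner_leviCivita (mdifferentiableAt_add_section hX hX') hY hZ.mdifferentiableAt,
    inner_add_left, inner_leviCivita hX hY hZ.mdifferentiableAt,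
    inner_leviCivita hX' hY hZ.mdifferentiableAt, koszul_add_left hX hX' hY hZ.mdifferentiableAt]
  ring

lemma leviCivita_smul_left (hf : MDiffAt f x) (hX : MDiffAt (T% X) x)
    (hY : MDiffAt (T% Y) x) :
    leviCivita I (f • X) Y x = f x • leviCivita I X Y x := by
  refine eq_of_inner_field fun Z hZ ↦ ?_
  rw [inner_leviCivita (hf.smul_section hX) hY hZ.mdifferentiableAt,
    real_inner_smul_left, inner_leviCivita hX hY hZ.mdifferentiableAt,
    koszul_smul_left hf hX hY hZ.mdifferentiableAt]
  ring

lemma leviCivita_add_right (hX : MDiffAt (T% X) x) (hY : MDiffAt (T% Y) x)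
    (hY' : MDiffAt (T% Y') x) :
    leviCivita I X (Y + Y') x = leviCivita I X Y x + leviCivita I X Y' x := by
  refine eq_of_inner_field fun Z hZ ↦ ?_
  rw [inner_leviCivita hX (mdifferentiableAt_add_section hY hY') hZ.mdifferentiableAt,
    inner_add_left, inner_leviCivita hX hY hZ.mdifferentiableAt,
    inner_leviCivita hX hY' hZ.mdifferentiableAt, koszul_add_right hY hY' hX hZ.mdifferentiableAt]
  ring

lemma leviCivita_smul_right (hf : MDiffAt f x) (hX : MDiffAt (T% X) x)
    (hY : MDiffAt (T% Y) x) :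
    leviCivita I X (f • Y) x = mvfderiv I f x (X x) • Y x + f x • leviCivita I X Y x := by
  refine eq_of_inner_field fun Z hZ ↦ ?_
  rw [inner_leviCivita hX (hf.smul_section hY) hZ.mdifferentiableAt, inner_add_left,
    real_inner_smul_left, real_inner_smul_left, inner_leviCivita hX hY hZ.mdifferentiableAt,
    koszul_smul_right hf hY hX hZ.mdifferentiableAt]
  ring

/-- The Levi-Civita connection is torsion-free. -/
lemma leviCivita_sub_leviCivita (hX : MDiffAt (T% X) x) (hY : MDiffAt (T% Y) x) :
    leviCivita I X Y x - leviCivita I Y X x = mlieBracket I X Y x := by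
  refine eq_of_inner_field fun Z hZ ↦ ?_
  rw [inner_sub_left, inner_leviCivita hX hY hZ.mdifferentiableAt,
    inner_leviCivita hY hX hZ.mdifferentiableAt]
  unfold koszul
  rw [metric_comm Y X, metric_comm Z X, metric_comm Z Y, mlieBracket_swap_apply (V := Y) (W := X),
    mlieBracket_swap_apply (V := X) (W := Z), mlieBracket_swap_apply (V := Z) (W := Y)]
  simp only [inner_neg_left]
  ring

/-- The Levi-Civita connection is compatible with the metric. -/
lemma mvfderiv_inner (hX : MDiffAt (T% X) x) (hY : MDiffAt (T% Y) x) (hZ : MDiffAt (T% Z) x) :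
    mvfderiv I (fun y ↦ inner ℝ (Y y) (Z y)) x (X x) =
      inner ℝ (leviCivita I X Y x) (Z x) + inner ℝ (Y x) (leviCivita I X Z x) := by
  rw [real_inner_comm _ (Y x), inner_leviCivita hX hY hZ, inner_leviCivita hX hZ hY]
  unfold koszul
  rw [metric_comm Z Y, metric_comm X Z, metric_comm X Y,
    mlieBracket_swap_apply (V := Z) (W := X),
    mlieBracket_swap_apply (V := Z) (W := Y), mlieBracket_swap_apply (V := Y) (W := X)]
  simp only [inner_neg_left]
  ring

lemma SmoothFieldNear.gramSchmidt {k : ℕ} {s : Fin k → Π x : M, TangentSpace I x}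
    (hs : ∀ i, SmoothFieldNear I (s i) x)
    (hlin : ∀ᶠ y in 𝓝 x, LinearIndependent ℝ (s · y)) (i : Fin k) :
    SmoothFieldNear I (fun y ↦ InnerProductSpace.gramSchmidt ℝ (s · y) i) x := by
  induction i using WellFoundedLT.induction with
  | ind i ih =>
    have hsum : ∀ᶠ y in 𝓝 x, ∀ j ∈ Finset.Iio i, SmoothFieldAt I
        (fun y ↦ InnerProductSpace.gramSchmidt ℝ (s · y) j) y :=
      (Finset.eventually_all _).2 fun j hj ↦ ih j (Finset.mem_Iio.1 hj)
    filter_upwards [hsum, hs i, hlin] with y hy hsi hl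
    have key : SmoothFieldAt I (s i - fun y ↦ ∑ j ∈ Finset.Iio i,
        (inner ℝ (InnerProductSpace.gramSchmidt ℝ (s · y) j) (s i y) /
          inner ℝ (InnerProductSpace.gramSchmidt ℝ (s · y) j)
            (InnerProductSpace.gramSchmidt ℝ (s · y) j) : ℝ) •
          InnerProductSpace.gramSchmidt ℝ (s · y) j) y := by
      refine ContMDiffAt.sub_section hsi (ContMDiffAt.sum_section fun j hj ↦ ?_)
      refine ContMDiffAt.smul_section (((hy j hj).metric hsi).div₀ ((hy j hj).metric (hy j hj)) ?_)
        (hy j hj)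
      exact inner_self_ne_zero.2 (InnerProductSpace.gramSchmidt_ne_zero j hl)
    refine key.congr (Eventually.of_forall fun z ↦ ?_)
    have h := InnerProductSpace.gramSchmidt_def'' ℝ (s · z) i
    simp only [RCLike.ofReal_real_eq_id, id, ← real_inner_self_eq_norm_sq] at h
    exact eq_sub_of_add_eq h.symm

lemma exists_orthonormal_field (x : M) :
    ∃ e : Fin (Module.finrank ℝ E) → Π x : M, TangentSpace I x,
      (∀ i, SmoothFieldNear I (e i) x) ∧ ∀ᶠ y in 𝓝 x, Orthonormal ℝ (e · y) := by
  let b := Module.finBasis ℝ E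
  let t := trivializationAt E (TangentSpace I) x
  have hx : x ∈ t.baseSet := FiberBundle.mem_baseSet_trivializationAt' x
  have hb : ∀ᶠ y in 𝓝 x, y ∈ t.baseSet := t.open_baseSet.mem_nhds hx
  have hfr := t.isLocalFrameOn_localFrame_baseSet I ∞ b
  have hs (i) : SmoothFieldNear I (t.localFrame b i) x := by
    filter_upwards [hb] with y hy using contMDiffAt_localFrame_of_mem ∞ t b i hy
  have hlin : ∀ᶠ y in 𝓝 x, LinearIndependent ℝ (t.localFrame b · y) := by
    filter_upwards [hb] with y hy using hfr.linearIndependent hy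
  refine ⟨fun i y ↦ InnerProductSpace.gramSchmidtNormed ℝ (t.localFrame b · y) i, fun i ↦ ?_, ?_⟩
  · filter_upwards [SmoothFieldNear.gramSchmidt hs hlin i, hlin] with y hy hl
    refine ContMDiffAt.smul_section (s := fun y ↦
      InnerProductSpace.gramSchmidt ℝ (t.localFrame b · y) i) ?_ hy
    have hne := inner_self_ne_zero (𝕜 := ℝ).2 (InnerProductSpace.gramSchmidt_ne_zero i hl)
    have h := (hy.metric hy).inv₀ hne
    have hsq : ContMDiffAt 𝓘(ℝ, ℝ) 𝓘(ℝ, ℝ) ∞ Real.sqrt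
        (inner ℝ (InnerProductSpace.gramSchmidt ℝ (t.localFrame b · y) i)
          (InnerProductSpace.gramSchmidt ℝ (t.localFrame b · y) i)) :=
      (Real.contDiffAt_sqrt hne).contMDiffAt
    have h2 := (ContMDiffAt.comp y hsq (hy.metric hy)).inv₀
      (by simpa [Real.sqrt_eq_zero'] using hne)
    refine h2.congr_of_eventuallyEq (Eventually.of_forall fun z ↦ ?_)
    exact congrArg (·⁻¹)
      (norm_eq_sqrt_real_inner (InnerProductSpace.gramSchmidt ℝ (t.localFrame b · z) i))
  · filter_upwards [hlin] with y hl using InnerProductSpace.gramSchmidtNormed_orthonormal hl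

/-- An orthonormal family of the right cardinality in a tangent space, as a basis. -/
def orthonormalBasisOf {e : Fin (Module.finrank ℝ E) → TangentSpace I x}
    (he : Orthonormal ℝ e) : OrthonormalBasis (Fin (Module.finrank ℝ E)) ℝ (TangentSpace I x) :=
  OrthonormalBasis.mk he (he.linearIndependent.span_eq_top_of_card_eq_finrank' (by
    rw [Fintype.card_fin]; rfl)).ge

lemma orthonormalBasisOf_apply {e : Fin (Module.finrank ℝ E) → TangentSpace I x}
    (he : Orthonormal ℝ e) (i) : orthonormalBasisOf he i = e i := by
  simp [orthonormalBasisOf]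

lemma SmoothFieldNear.koszul (hX : SmoothFieldNear I X x) (hY : SmoothFieldNear I Y x)
    (hZ : SmoothFieldNear I Z x) : SmoothFunNear I (koszul I X Y Z) x :=
  ((((((hY.metric hZ).derivAlong hX).add ((hZ.metric hX).derivAlong hY)).sub
    ((hX.metric hY).derivAlong hZ)).add ((hX.lieBracket hY).metric hZ)).sub
    ((hY.lieBracket hZ).metric hX)).add ((hZ.lieBracket hX).metric hY)

lemma SmoothFieldNear.leviCivita (hX : SmoothFieldNear I X x) (hY : SmoothFieldNear I Y x) :
    SmoothFieldNear I (leviCivita I X Y) x := by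
  obtain ⟨e, he, hon⟩ := exists_orthonormal_field (I := I) x
  have hsm : SmoothFieldNear I
      (fun y ↦ ∑ i, ((fun _ : M ↦ (1 / 2 : ℝ)) * YamabeSoliton.koszul I X Y (e i)) y • e i y) x :=
    SmoothFieldNear.sum fun i ↦ (he i).smul ((smoothFunNear_const _).mul (hX.koszul hY (he i)))
  refine hsm.congr ?_
  have hall : ∀ᶠ y in 𝓝 x, ∀ i, SmoothFieldAt I (e i) y := eventually_all.2 he
  filter_upwards [hX, hY, hon, hall] with y hXy hYy hony hey
  rw [← (orthonormalBasisOf hony).sum_repr' (YamabeSoliton.leviCivita I X Y y)]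
  refine Finset.sum_congr rfl fun i _ ↦ ?_
  rw [orthonormalBasisOf_apply, real_inner_comm, inner_leviCivita hXy.mdifferentiableAt
    hYy.mdifferentiableAt (hey i).mdifferentiableAt]
  rfl

end LeviCivita

section Curvature

variable {E : Type*} [NormedAddCommGroup E] [NormedSpace ℝ E] [FiniteDimensional ℝ E]
  {H : Type*} [TopologicalSpace H] {I : ModelWithCorners ℝ E H}
  {M : Type*} [TopologicalSpace M] [ChartedSpace H M] [IsManifold I ∞ M]
  [RiemannianBundle (fun x : M ↦ TangentSpace I x)]
  [IsContMDiffRiemannianBundle I ∞ E (fun x : M ↦ TangentSpace I x)]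
  {f g : M → ℝ} {X X' Y Y' Z Z' V : Π x : M, TangentSpace I x} {x : M}

lemma mlieBracket_sub_right (hX : MDiffAt (T% X) x) (hY : MDiffAt (T% Y) x) :
    mlieBracket I V (X - Y) x = mlieBracket I V X x - mlieBracket I V Y x := by
  have : CompleteSpace E := FiniteDimensional.complete ℝ E
  have h := mlieBracket_add_right (V := V) (W := X - Y) (W₁ := Y)
    (mdifferentiableAt_sub_section hX hY) hY
  rw [sub_add_cancel] at h
  rw [h, add_sub_cancel_right]

lemma mlieBracket_mlieBracket_eventuallyEq (hX : SmoothFieldNear I X x)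
    (hY : SmoothFieldNear I Y x) (hZ : SmoothFieldNear I Z x) :
    mlieBracket I X (mlieBracket I Y Z) =ᶠ[𝓝 x]
      mlieBracket I (mlieBracket I X Y) Z + mlieBracket I Y (mlieBracket I X Z) := by
  filter_upwards [hX, hY, hZ] with y h h' h'' using mlieBracket_mlieBracket h h' h''

lemma leviCivita_neg_left (hX : MDiffAt (T% X) x) (hY : MDiffAt (T% Y) x) :
    leviCivita I (-X) Y x = -leviCivita I X Y x := by
  have h := leviCivita_smul_left (f := fun _ ↦ -1) mdifferentiableAt_const hX hY
  rw [neg_one_smul] at h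
  rw [← h]
  congr 1
  ext y
  simp

lemma SmoothFieldNear.riemannCurvature (hX : SmoothFieldNear I X x) (hY : SmoothFieldNear I Y x)
    (hZ : SmoothFieldNear I Z x) : SmoothFieldNear I (riemannCurvature I X Y Z) x :=
  ((hX.leviCivita (hY.leviCivita hZ)).sub (hY.leviCivita (hX.leviCivita hZ))).sub
    ((hX.lieBracket hY).leviCivita hZ)

lemma riemannCurvature_congr (hX : X =ᶠ[𝓝 x] X') (hY : Y =ᶠ[𝓝 x] Y') (hZ : Z =ᶠ[𝓝 x] Z') :
    riemannCurvature I X Y Z x = riemannCurvature I X' Y' Z' x := by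
  unfold riemannCurvature
  rw [leviCivita_congr hX (leviCivita_eventuallyEq hY hZ),
    leviCivita_congr hY (leviCivita_eventuallyEq hX hZ),
    leviCivita_congr (hX.mlieBracket_vectorField hY) hZ]

lemma riemannCurvature_swap (hX : SmoothFieldNear I X x) (hY : SmoothFieldNear I Y x)
    (hZ : SmoothFieldNear I Z x) :
    riemannCurvature I X Y Z x = -riemannCurvature I Y X Z x := by
  unfold riemannCurvature
  rw [mlieBracket_swap (V := X) (W := Y),
    leviCivita_neg_left (hY.lieBracket hX).mdifferentiableAt hZ.mdifferentiableAt]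
  abel

lemma riemannCurvature_add_left (hX : SmoothFieldNear I X x) (hX' : SmoothFieldNear I X' x)
    (hY : SmoothFieldNear I Y x) (hZ : SmoothFieldNear I Z x) :
    riemannCurvature I (X + X') Y Z x
      = riemannCurvature I X Y Z x + riemannCurvature I X' Y Z x := by
  have : CompleteSpace E := FiniteDimensional.complete ℝ E
  have h1 : leviCivita I (X + X') Z =ᶠ[𝓝 x] leviCivita I X Z + leviCivita I X' Z := by
    filter_upwards [hX, hX', hZ] with y h h' h'' using
      leviCivita_add_left h.mdifferentiableAt h'.mdifferentiableAt h''.mdifferentiableAt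
  have h2 : mlieBracket I (X + X') Y =ᶠ[𝓝 x] mlieBracket I X Y + mlieBracket I X' Y := by
    filter_upwards [hX, hX'] with y h h' using
      mlieBracket_add_left h.mdifferentiableAt h'.mdifferentiableAt
  unfold riemannCurvature
  rw [leviCivita_congr (EventuallyEq.refl _ Y) h1, leviCivita_congr h2 (EventuallyEq.refl _ Z),
    leviCivita_add_left hX.mdifferentiableAt hX'.mdifferentiableAt
      (hY.leviCivita hZ).mdifferentiableAt,
    leviCivita_add_left (hX.lieBracket hY).mdifferentiableAt (hX'.lieBracket hY).mdifferentiableAt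
      hZ.mdifferentiableAt,
    leviCivita_add_right hY.mdifferentiableAt (hX.leviCivita hZ).mdifferentiableAt
      (hX'.leviCivita hZ).mdifferentiableAt]
  abel

lemma riemannCurvature_smul_left (hf : SmoothFunNear I f x) (hX : SmoothFieldNear I X x)
    (hY : SmoothFieldNear I Y x) (hZ : SmoothFieldNear I Z x) :
    riemannCurvature I (f • X) Y Z x = f x • riemannCurvature I X Y Z x := by
  have : CompleteSpace E := FiniteDimensional.complete ℝ E
  have h1 : leviCivita I (f • X) Z =ᶠ[𝓝 x] f • leviCivita I X Z := by
    filter_upwards [hf.eventually, hX, hZ] with y h h' h'' using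
      leviCivita_smul_left h.mdifferentiableAt h'.mdifferentiableAt h''.mdifferentiableAt
  have h2 : mlieBracket I (f • X) Y =ᶠ[𝓝 x]
      (((fun _ ↦ 0) - fun y ↦ mvfderiv I f y (Y y)) • X + f • mlieBracket I X Y :
        Π x : M, TangentSpace I x) := by
    filter_upwards [hf.eventually, hX] with y h h'
    rw [mlieBracket_smul_left h.mdifferentiableAt h'.mdifferentiableAt]
    simp
    rfl
  have hfY := (smoothFunNear_const (I := I) (x := x) 0).sub (hf.derivAlong hY)
  unfold riemannCurvature
  rw [leviCivita_congr (EventuallyEq.refl _ Y) h1, leviCivita_congr h2 (EventuallyEq.refl _ Z),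
    leviCivita_smul_left hf.mdifferentiableAt hX.mdifferentiableAt
      (hY.leviCivita hZ).mdifferentiableAt,
    leviCivita_add_left (hX.smul hfY).mdifferentiableAt ((hX.lieBracket hY).smul hf).mdifferentiableAt
      hZ.mdifferentiableAt,
    leviCivita_smul_left hfY.mdifferentiableAt hX.mdifferentiableAt hZ.mdifferentiableAt,
    leviCivita_smul_left hf.mdifferentiableAt (hX.lieBracket hY).mdifferentiableAt
      hZ.mdifferentiableAt,
    leviCivita_smul_right hf.mdifferentiableAt hY.mdifferentiableAt
      (hX.leviCivita hZ).mdifferentiableAt]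
  simp only [Pi.sub_apply, zero_sub, neg_smul, smul_sub]
  abel

lemma riemannCurvature_add_right (hX : SmoothFieldNear I X x)
    (hY : SmoothFieldNear I Y x) (hZ : SmoothFieldNear I Z x) (hZ' : SmoothFieldNear I Z' x) :
    riemannCurvature I X Y (Z + Z') x
      = riemannCurvature I X Y Z x + riemannCurvature I X Y Z' x := by
  have h (W : Π x : M, TangentSpace I x) (hW : SmoothFieldNear I W x) :
      leviCivita I W (Z + Z') =ᶠ[𝓝 x] leviCivita I W Z + leviCivita I W Z' := by
    filter_upwards [hW, hZ, hZ'] with y h h' h'' using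
      leviCivita_add_right h.mdifferentiableAt h'.mdifferentiableAt h''.mdifferentiableAt
  unfold riemannCurvature
  rw [leviCivita_congr (EventuallyEq.refl _ X) (h Y hY),
    leviCivita_congr (EventuallyEq.refl _ Y) (h X hX), (h _ (hX.lieBracket hY)).self_of_nhds,
    leviCivita_add_right hX.mdifferentiableAt (hY.leviCivita hZ).mdifferentiableAt
      (hY.leviCivita hZ').mdifferentiableAt,
    leviCivita_add_right hY.mdifferentiableAt (hX.leviCivita hZ).mdifferentiableAt
      (hX.leviCivita hZ').mdifferentiableAt]
  simp only [Pi.add_apply]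
  abel

lemma riemannCurvature_smul_right (hf : SmoothFunNear I f x) (hX : SmoothFieldNear I X x)
    (hY : SmoothFieldNear I Y x) (hZ : SmoothFieldNear I Z x) :
    riemannCurvature I X Y (f • Z) x = f x • riemannCurvature I X Y Z x := by
  have h (W : Π x : M, TangentSpace I x) (hW : SmoothFieldNear I W x) :
      leviCivita I W (f • Z) =ᶠ[𝓝 x]
        (fun y ↦ mvfderiv I f y (W y)) • Z + f • leviCivita I W Z := by
    filter_upwards [hW, hf.eventually, hZ] with y h h' h'' using
      leviCivita_smul_right h'.mdifferentiableAt h.mdifferentiableAt h''.mdifferentiableAt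
  have expand {A B : Π x : M, TangentSpace I x} (hA : SmoothFieldNear I A x)
      (hB : SmoothFieldNear I B x) :
      leviCivita I A (leviCivita I B (f • Z)) x =
        mvfderiv I (fun y ↦ mvfderiv I f y (B y)) x (A x) • Z x
          + mvfderiv I f x (B x) • leviCivita I A Z x
          + mvfderiv I f x (A x) • leviCivita I B Z x
          + f x • leviCivita I A (leviCivita I B Z) x := by
    rw [leviCivita_congr (EventuallyEq.refl _ A) (h B hB),
      leviCivita_add_right hA.mdifferentiableAt (hZ.smul (hf.derivAlong hB)).mdifferentiableAt
        ((hB.leviCivita hZ).smul hf).mdifferentiableAt,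
      leviCivita_smul_right (hf.derivAlong hB).mdifferentiableAt hA.mdifferentiableAt
        hZ.mdifferentiableAt,
      leviCivita_smul_right hf.mdifferentiableAt hA.mdifferentiableAt
        (hB.leviCivita hZ).mdifferentiableAt]
    abel
  unfold riemannCurvature
  rw [expand hX hY, expand hY hX, (h _ (hX.lieBracket hY)).self_of_nhds]
  simp only [Pi.add_apply, Pi.smul_apply', ← mvfderiv_mvfderiv_sub hf hX hY, sub_smul, smul_sub]
  abel

lemma eventuallyEq_sum_orthonormal {e : Fin (Module.finrank ℝ E) → Π x : M, TangentSpace I x}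
    (hon : ∀ᶠ y in 𝓝 x, Orthonormal ℝ (e · y)) (X : Π x : M, TangentSpace I x) :
    X =ᶠ[𝓝 x] (fun y ↦ ∑ i, ((fun y ↦ (inner ℝ (e i y) (X y) : ℝ)) • e i) y :
      Π x : M, TangentSpace I x) := by
  filter_upwards [hon] with y hy
  conv_lhs => rw [← (orthonormalBasisOf hy).sum_repr' (X y)]
  simp only [orthonormalBasisOf_apply, Pi.smul_apply']
  rfl

/-- A `C^∞`-linear local operation on vector fields, expanded in an orthonormal frame. -/
lemma tensorial_expand {A : Type*} [AddCommGroup A] [Module ℝ A]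
    {Φ : (Π x : M, TangentSpace I x) → A}
    (hcongr : ∀ {X Y : Π x : M, TangentSpace I x}, X =ᶠ[𝓝 x] Y → Φ X = Φ Y)
    (hadd : ∀ {X Y}, SmoothFieldNear I X x → SmoothFieldNear I Y x → Φ (X + Y) = Φ X + Φ Y)
    (hsmul : ∀ {f : M → ℝ} {X}, SmoothFunNear I f x → SmoothFieldNear I X x →
      Φ (f • X) = f x • Φ X)
    {e : Fin (Module.finrank ℝ E) → Π x : M, TangentSpace I x}
    (he : ∀ i, SmoothFieldNear I (e i) x) (hon : ∀ᶠ y in 𝓝 x, Orthonormal ℝ (e · y))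
    (hX : SmoothFieldNear I X x) :
    Φ X = ∑ i, (inner ℝ (e i x) (X x) : ℝ) • Φ (e i) := by
  have hsm (i) : SmoothFieldNear I ((fun y ↦ (inner ℝ (e i y) (X y) : ℝ)) • e i) x :=
    (he i).smul ((he i).metric hX)
  have hsum (s : Finset (Fin (Module.finrank ℝ E))) :
      Φ (fun y ↦ ∑ i ∈ s, ((fun y ↦ (inner ℝ (e i y) (X y) : ℝ)) • e i) y) =
        ∑ i ∈ s, (inner ℝ (e i x) (X x) : ℝ) • Φ (e i) := by
    classical
    induction s using Finset.induction_on with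
    | empty =>
      have h := hsmul (f := fun _ ↦ 0) (smoothFunNear_const 0) hX
      rw [zero_smul] at h
      simp only [Finset.sum_empty]
      rw [← h]
      congr 1
      ext y
      simp
    | insert a s ha ih =>
      rw [Finset.sum_insert ha, ← ih, ← hsmul ((he a).metric hX) (he a),
        ← hadd (hsm a) (SmoothFieldNear.sum hsm)]
      congr 1
      ext y
      rw [Finset.sum_insert ha]
      rfl
  rw [hcongr (eventuallyEq_sum_orthonormal hon X), hsum]

section Frame

variable {e : Fin (Module.finrank ℝ E) → Π x : M, TangentSpace I x}

lemma riemannCurvature_expand_left (he : ∀ i, SmoothFieldNear I (e i) x)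
    (hon : ∀ᶠ y in 𝓝 x, Orthonormal ℝ (e · y)) (hX : SmoothFieldNear I X x)
    (hY : SmoothFieldNear I Y x) (hZ : SmoothFieldNear I Z x) :
    riemannCurvature I X Y Z x =
      ∑ i, (inner ℝ (e i x) (X x) : ℝ) • riemannCurvature I (e i) Y Z x :=
  tensorial_expand (Φ := fun X ↦ riemannCurvature I X Y Z x)
    (fun h ↦ riemannCurvature_congr h (EventuallyEq.refl _ Y) (EventuallyEq.refl _ Z))
    (fun h h' ↦ riemannCurvature_add_left h h' hY hZ)
    (fun h h' ↦ riemannCurvature_smul_left h h' hY hZ) he hon hX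

lemma riemannCurvature_expand_middle (he : ∀ i, SmoothFieldNear I (e i) x)
    (hon : ∀ᶠ y in 𝓝 x, Orthonormal ℝ (e · y)) (hX : SmoothFieldNear I X x)
    (hY : SmoothFieldNear I Y x) (hZ : SmoothFieldNear I Z x) :
    riemannCurvature I X Y Z x =
      ∑ i, (inner ℝ (e i x) (Y x) : ℝ) • riemannCurvature I X (e i) Z x := by
  rw [riemannCurvature_swap hX hY hZ, riemannCurvature_expand_left he hon hY hX hZ,
    ← Finset.sum_neg_distrib]
  refine Finset.sum_congr rfl fun i _ ↦ ?_
  rw [riemannCurvature_swap hX (he i) hZ, smul_neg]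

lemma riemannCurvature_expand_right (he : ∀ i, SmoothFieldNear I (e i) x)
    (hon : ∀ᶠ y in 𝓝 x, Orthonormal ℝ (e · y)) (hX : SmoothFieldNear I X x)
    (hY : SmoothFieldNear I Y x) (hZ : SmoothFieldNear I Z x) :
    riemannCurvature I X Y Z x =
      ∑ i, (inner ℝ (e i x) (Z x) : ℝ) • riemannCurvature I X Y (e i) x :=
  tensorial_expand (Φ := fun Z ↦ riemannCurvature I X Y Z x)
    (fun h ↦ riemannCurvature_congr (EventuallyEq.refl _ X) (EventuallyEq.refl _ Y) h)
    (fun h h' ↦ riemannCurvature_add_right hX hY h h')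
    (fun h h' ↦ riemannCurvature_smul_right h hX hY h') he hon hZ

lemma scalarCurvature_eq_sum (he : ∀ i, SmoothFieldNear I (e i) x)
    (hon : ∀ᶠ y in 𝓝 x, Orthonormal ℝ (e · y)) :
    scalarCurvature I x =
      ∑ i, ∑ j, inner ℝ (riemannCurvature I (e i) (e j) (e j) x) (e i x) := by
  have hF (i) := smoothFieldNear_extendVector (frame I x i)
  have h1 (j) : ∑ i, (inner ℝ (riemannCurvature I (extendVector I (frame I x i))
        (extendVector I (frame I x j)) (extendVector I (frame I x j)) x) (frame I x i) : ℝ) =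
      ∑ k, inner ℝ (riemannCurvature I (e k)
        (extendVector I (frame I x j)) (extendVector I (frame I x j)) x) (e k x) := by
    have h (i) := riemannCurvature_expand_left he hon (hF i) (hF j) (hF j)
    simp only [h, extendVector_self, sum_inner, real_inner_smul_left]
    rw [Finset.sum_comm]
    refine Finset.sum_congr rfl fun k _ ↦ ?_
    rw [← (frame I x).sum_inner_mul_inner]
    exact Finset.sum_congr rfl fun i _ ↦ by rw [real_inner_comm (e k x), mul_comm]
  have h2 (k) : ∑ j, (inner ℝ (riemannCurvature I (e k)
        (extendVector I (frame I x j)) (extendVector I (frame I x j)) x) (e k x) : ℝ) =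
      ∑ l, inner ℝ (riemannCurvature I (e k) (e l) (e l) x) (e k x) := by
    have h (j) := riemannCurvature_expand_middle he hon (he k) (hF j) (hF j)
    have h' (j l) := riemannCurvature_expand_right he hon (he k) (he l) (hF j)
    simp only [h, h', extendVector_self, sum_inner, real_inner_smul_left, Finset.mul_sum]
    rw [Finset.sum_comm]
    refine Finset.sum_congr rfl fun l _ ↦ ?_
    rw [Finset.sum_comm]
    have hm (m) : ∑ j, (inner ℝ (e l x) (frame I x j) : ℝ) * (inner ℝ (e m x) (frame I x j) *
        inner ℝ (riemannCurvature I (e k) (e l) (e m) x) (e k x)) =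
        inner ℝ (e l x) (e m x) *
          inner ℝ (riemannCurvature I (e k) (e l) (e m) x) (e k x) := by
      rw [← (frame I x).sum_inner_mul_inner (e l x) (e m x), Finset.sum_mul]
      exact Finset.sum_congr rfl fun j _ ↦ by rw [real_inner_comm (e m x), mul_assoc]
    simp only [hm, orthonormal_iff_ite.1 hon.self_of_nhds]
    simp
  unfold scalarCurvature
  rw [Finset.sum_comm]
  simp only [h1]
  rw [Finset.sum_comm]
  simp only [h2]

end Frame

end Curvature

section Homothety

variable {E : Type*} [NormedAddCommGroup E] [NormedSpace ℝ E] [FiniteDimensional ℝ E]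
  {H : Type*} [TopologicalSpace H] {I : ModelWithCorners ℝ E H}
  {M : Type*} [TopologicalSpace M] [ChartedSpace H M] [IsManifold I ∞ M]
  [RiemannianBundle (fun x : M ↦ TangentSpace I x)]

variable (I) in
/-- `V` is a smooth vector field with `L_V g = 2 g`. -/
structure IsHomothetic (V : Π x : M, TangentSpace I x) : Prop where
  smooth : SmoothField I V
  equation : ∀ {x : M} {X Y : Π x : M, TangentSpace I x},
    SmoothFieldAt I X x → SmoothFieldAt I Y x →
    lieDerivMetric I V X Y x = 2 * inner ℝ (X x) (Y x)

variable [IsContMDiffRiemannianBundle I ∞ E (fun x : M ↦ TangentSpace I x)]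
  {f g : M → ℝ} {X X' Y Y' Z Z' V : Π x : M, TangentSpace I x} {x : M}

namespace IsHomothetic

lemma mvfderiv_metric (hV : IsHomothetic I V) (hX : SmoothFieldAt I X x)
    (hY : SmoothFieldAt I Y x) :
    mvfderiv I (fun y ↦ inner ℝ (X y) (Y y)) x (V x) =
      inner ℝ (mlieBracket I V X x) (Y x) + inner ℝ (X x) (mlieBracket I V Y x)
        + 2 * inner ℝ (X x) (Y x) := by
  have h := hV.equation hX hY
  unfold lieDerivMetric at h
  linarith

lemma mvfderiv_mvfderiv_metric (hV : IsHomothetic I V) (hX : SmoothFieldNear I X x)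
    (hY : SmoothFieldNear I Y x) (hZ : SmoothFieldNear I Z x) :
    mvfderiv I (fun y ↦ mvfderiv I (fun y ↦ inner ℝ (Y y) (Z y)) y (X y)) x (V x) =
      mvfderiv I (fun y ↦ inner ℝ (Y y) (Z y)) x (mlieBracket I V X x)
        + mvfderiv I (fun y ↦ inner ℝ (mlieBracket I V Y y) (Z y)) x (X x)
        + mvfderiv I (fun y ↦ inner ℝ (Y y) (mlieBracket I V Z y)) x (X x)
        + 2 * mvfderiv I (fun y ↦ inner ℝ (Y y) (Z y)) x (X x) := by
  have hVs : SmoothFieldNear I V x := hV.smooth.near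
  have h1 := mvfderiv_mvfderiv_sub (hY.metric hZ) hVs hX
  have h2 : (fun y ↦ mvfderiv I (fun y ↦ inner ℝ (Y y) (Z y)) y (V y)) =ᶠ[𝓝 x]
      (fun y ↦ inner ℝ (mlieBracket I V Y y) (Z y)) + (fun y ↦ inner ℝ (Y y) (mlieBracket I V Z y))
        + (fun _ ↦ 2) * fun y ↦ inner ℝ (Y y) (Z y) := by
    filter_upwards [hY, hZ] with y h h' using hV.mvfderiv_metric h h'
  have m1 := ((hVs.lieBracket hY).metric hZ)
  have m2 := (hY.metric (hVs.lieBracket hZ))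
  rw [mvfderiv_congr h2, mvfderiv_add (m1.add m2).mdifferentiableAt
    ((smoothFunNear_const (2 : ℝ)).mul (hY.metric hZ)).mdifferentiableAt,
    mvfderiv_add m1.mdifferentiableAt m2.mdifferentiableAt,
    mvfderiv_mul mdifferentiableAt_const (hY.metric hZ).mdifferentiableAt,
    mvfderiv_const] at h1
  simp only [add_apply, smul_apply, smul_zero, add_zero, smul_eq_mul] at h1
  linarith

lemma mvfderiv_metric_mlieBracket (hV : IsHomothetic I V) (hX : SmoothFieldNear I X x)
    (hY : SmoothFieldNear I Y x) (hZ : SmoothFieldNear I Z x) :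
    mvfderiv I (fun y ↦ inner ℝ (mlieBracket I X Y y) (Z y)) x (V x) =
      inner ℝ (mlieBracket I (mlieBracket I V X) Y x) (Z x)
        + inner ℝ (mlieBracket I X (mlieBracket I V Y) x) (Z x)
        + inner ℝ (mlieBracket I X Y x) (mlieBracket I V Z x)
        + 2 * inner ℝ (mlieBracket I X Y x) (Z x) := by
  rw [hV.mvfderiv_metric (hX.lieBracket hY).self hZ.self,
    mlieBracket_mlieBracket (hV.smooth x) hX.self hY.self, inner_add_left]

lemma mvfderiv_koszul (hV : IsHomothetic I V) (hX : SmoothFieldNear I X x)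
    (hY : SmoothFieldNear I Y x) (hZ : SmoothFieldNear I Z x) :
    mvfderiv I (koszul I X Y Z) x (V x) =
      koszul I (mlieBracket I V X) Y Z x + koszul I X (mlieBracket I V Y) Z x
        + koszul I X Y (mlieBracket I V Z) x + 2 * koszul I X Y Z x := by
  have a1 := (hY.metric hZ).derivAlong hX
  have a2 := (hZ.metric hX).derivAlong hY
  have a3 := (hX.metric hY).derivAlong hZ
  have a4 := (hX.lieBracket hY).metric hZ
  have a5 := (hY.lieBracket hZ).metric hX
  have a6 := (hZ.lieBracket hX).metric hY
  have h : koszul I X Y Z =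
      (fun y ↦ mvfderiv I (fun y ↦ inner ℝ (Y y) (Z y)) y (X y))
        + (fun y ↦ mvfderiv I (fun y ↦ inner ℝ (Z y) (X y)) y (Y y))
        - (fun y ↦ mvfderiv I (fun y ↦ inner ℝ (X y) (Y y)) y (Z y))
        + (fun y ↦ inner ℝ (mlieBracket I X Y y) (Z y))
        - (fun y ↦ inner ℝ (mlieBracket I Y Z y) (X y))
        + (fun y ↦ inner ℝ (mlieBracket I Z X y) (Y y)) := rfl
  rw [h, mvfderiv_add ((((a1.add a2).sub a3).add a4).sub a5).mdifferentiableAt a6.mdifferentiableAt,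
    mvfderiv_sub (((a1.add a2).sub a3).add a4).mdifferentiableAt a5.mdifferentiableAt,
    mvfderiv_add ((a1.add a2).sub a3).mdifferentiableAt a4.mdifferentiableAt,
    mvfderiv_sub (a1.add a2).mdifferentiableAt a3.mdifferentiableAt,
    mvfderiv_add a1.mdifferentiableAt a2.mdifferentiableAt]
  simp only [add_apply, sub_apply, Pi.add_apply, Pi.sub_apply, hV.mvfderiv_mvfderiv_metric hX hY hZ,
    hV.mvfderiv_mvfderiv_metric hY hZ hX, hV.mvfderiv_mvfderiv_metric hZ hX hY,
    hV.mvfderiv_metric_mlieBracket hX hY hZ, hV.mvfderiv_metric_mlieBracket hY hZ hX,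
    hV.mvfderiv_metric_mlieBracket hZ hX hY]
  unfold koszul
  ring

/-- The flow of a homothetic vector field preserves the Levi-Civita connection. -/
lemma mlieBracket_leviCivita (hV : IsHomothetic I V) (hX : SmoothFieldNear I X x)
    (hY : SmoothFieldNear I Y x) :
    mlieBracket I V (leviCivita I X Y) x =
      leviCivita I (mlieBracket I V X) Y x + leviCivita I X (mlieBracket I V Y) x := by
  have hVs : SmoothFieldNear I V x := hV.smooth.near
  refine eq_of_inner_field fun Z hZ ↦ ?_
  have h1 := hV.mvfderiv_metric (hX.leviCivita hY).self hZ.self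
  have h2 : (fun y ↦ inner ℝ (leviCivita I X Y y) (Z y)) =ᶠ[𝓝 x]
      (fun _ ↦ 1 / 2) * koszul I X Y Z := by
    filter_upwards [hX, hY, hZ] with y h h' h''
    exact inner_leviCivita h.mdifferentiableAt h'.mdifferentiableAt h''.mdifferentiableAt
  rw [mvfderiv_congr h2, mvfderiv_mul mdifferentiableAt_const (hX.koszul hY hZ).mdifferentiableAt,
    mvfderiv_const] at h1
  simp only [smul_apply, smul_zero, add_zero, smul_eq_mul,
    hV.mvfderiv_koszul hX hY hZ] at h1
  have hz := hZ.mdifferentiableAt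
  rw [inner_leviCivita hX.mdifferentiableAt hY.mdifferentiableAt
    (hVs.lieBracket hZ).mdifferentiableAt,
    inner_leviCivita hX.mdifferentiableAt hY.mdifferentiableAt hz] at h1
  rw [inner_add_left, inner_leviCivita (hVs.lieBracket hX).mdifferentiableAt
    hY.mdifferentiableAt hz,
    inner_leviCivita hX.mdifferentiableAt (hVs.lieBracket hY).mdifferentiableAt hz]
  linarith

lemma mlieBracket_leviCivita_eventuallyEq (hV : IsHomothetic I V) (hX : SmoothFieldNear I X x)
    (hY : SmoothFieldNear I Y x) :
    mlieBracket I V (leviCivita I X Y) =ᶠ[𝓝 x]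
      leviCivita I (mlieBracket I V X) Y + leviCivita I X (mlieBracket I V Y) := by
  filter_upwards [hX.eventually, hY.eventually] with y h h' using hV.mlieBracket_leviCivita h h'

/-- The flow of a homothetic vector field preserves the curvature. -/
lemma mlieBracket_riemannCurvature (hV : IsHomothetic I V) (hX : SmoothFieldNear I X x)
    (hY : SmoothFieldNear I Y x) (hZ : SmoothFieldNear I Z x) :
    mlieBracket I V (riemannCurvature I X Y Z) x =
      riemannCurvature I (mlieBracket I V X) Y Z x + riemannCurvature I X (mlieBracket I V Y) Z x
        + riemannCurvature I X Y (mlieBracket I V Z) x := by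
  have hVs : SmoothFieldNear I V x := hV.smooth.near
  have hVX := hVs.lieBracket hX
  have hVY := hVs.lieBracket hY
  have hVZ := hVs.lieBracket hZ
  have h : riemannCurvature I X Y Z = leviCivita I X (leviCivita I Y Z)
      - leviCivita I Y (leviCivita I X Z) - leviCivita I (mlieBracket I X Y) Z := rfl
  have second {A B : Π x : M, TangentSpace I x} (hA : SmoothFieldNear I A x)
      (hB : SmoothFieldNear I B x) :
      mlieBracket I V (leviCivita I A (leviCivita I B Z)) x =
        leviCivita I (mlieBracket I V A) (leviCivita I B Z) x
          + leviCivita I A (leviCivita I (mlieBracket I V B) Z) x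
          + leviCivita I A (leviCivita I B (mlieBracket I V Z)) x := by
    rw [hV.mlieBracket_leviCivita hA (hB.leviCivita hZ),
      leviCivita_congr (EventuallyEq.refl _ A) (hV.mlieBracket_leviCivita_eventuallyEq hB hZ),
      leviCivita_add_right hA.mdifferentiableAt ((hVs.lieBracket hB).leviCivita hZ).mdifferentiableAt
        (hB.leviCivita hVZ).mdifferentiableAt, add_assoc]
  rw [h, mlieBracket_sub_right
      ((hX.leviCivita (hY.leviCivita hZ)).sub (hY.leviCivita (hX.leviCivita hZ))).mdifferentiableAt
      ((hX.lieBracket hY).leviCivita hZ).mdifferentiableAt,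
    mlieBracket_sub_right (hX.leviCivita (hY.leviCivita hZ)).mdifferentiableAt
      (hY.leviCivita (hX.leviCivita hZ)).mdifferentiableAt,
    second hX hY, second hY hX, hV.mlieBracket_leviCivita (hX.lieBracket hY) hZ,
    leviCivita_congr (mlieBracket_mlieBracket_eventuallyEq hVs hX hY) (EventuallyEq.refl _ Z),
    leviCivita_add_left (hVX.lieBracket hY).mdifferentiableAt (hX.lieBracket hVY).mdifferentiableAt
      hZ.mdifferentiableAt]
  unfold riemannCurvature
  abel

end IsHomothetic

lemma sum_mul_add_swap {κ : Type*} [Fintype κ] [DecidableEq κ] {c A : κ → κ → ℝ}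
    (hc : ∀ i k, c i k + c k i = if i = k then -2 else 0) :
    ∑ i, ∑ k, c i k * (A k i + A i k) = -2 * ∑ i, A i i := by
  have h : ∑ i, ∑ k, c i k * A i k = ∑ i, ∑ k, c k i * A k i := Finset.sum_comm
  simp only [mul_add, Finset.sum_add_distrib, h]
  simp only [← Finset.sum_add_distrib, ← add_mul, hc]
  simp [Finset.mul_sum]

lemma mvfderiv_finset_sum {κ : Type*} (s : Finset κ) {f : κ → M → ℝ}
    (hf : ∀ i ∈ s, MDiffAt (f i) x) :
    mvfderiv I (fun y ↦ ∑ i ∈ s, f i y) x = ∑ i ∈ s, mvfderiv I (f i) x ∧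
      MDiffAt (fun y ↦ ∑ i ∈ s, f i y) x := by
  classical
  induction s using Finset.induction_on with
  | empty => simpa using ⟨mvfderiv_const (I := I) (0 : ℝ), mdifferentiableAt_const⟩
  | insert a s ha ih =>
    obtain ⟨h1, h2⟩ := ih fun i hi ↦ hf i (Finset.mem_insert_of_mem hi)
    have ha' := hf a (Finset.mem_insert_self a s)
    have h : (fun y ↦ ∑ i ∈ insert a s, f i y) = f a + fun y ↦ ∑ i ∈ s, f i y := by
      ext y
      simp [ha]
    rw [h, Finset.sum_insert ha, ← h1, mvfderiv_add ha' h2]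
    exact ⟨rfl, ha'.add h2⟩

/-- Under a homothety, the scalar curvature scales with weight `-2`. -/
lemma IsHomothetic.mvfderiv_scalarCurvature (hV : IsHomothetic I V) (x : M) :
    mvfderiv I (scalarCurvature I) x (V x) = -2 * scalarCurvature I x := by
  have hVs : SmoothFieldNear I V x := hV.smooth.near
  obtain ⟨e, he, hon⟩ := exists_orthonormal_field (I := I) x
  have hall : ∀ᶠ y in 𝓝 x, ∀ i, SmoothFieldNear I (e i) y :=
    eventually_all.2 fun i ↦ (he i).eventually
  have hR : scalarCurvature I =ᶠ[𝓝 x] fun y ↦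
      ∑ i, ∑ j, inner ℝ (riemannCurvature I (e i) (e j) (e j) y) (e i y) := by
    filter_upwards [hall, eventually_eventually_nhds.2 hon] with y h h'
    exact scalarCurvature_eq_sum h h'
  have hVe (i) := hVs.lieBracket (he i)
  have hRm (i j) := (he i).riemannCurvature (he j) (he j)
  have hd (i j) := ((hRm i j).metric (he i)).mdifferentiableAt
  set T : Fin (Module.finrank ℝ E) → Fin (Module.finrank ℝ E) → Fin (Module.finrank ℝ E) →
    Fin (Module.finrank ℝ E) → ℝ := fun i j k l ↦
      inner ℝ (riemannCurvature I (e i) (e j) (e k) x) (e l x) with hT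
  set c : Fin (Module.finrank ℝ E) → Fin (Module.finrank ℝ E) → ℝ := fun i k ↦
    inner ℝ (e k x) (mlieBracket I V (e i) x) with hcdef
  have hc (i k) : c i k + c k i = if i = k then -2 else 0 := by
    have h := hV.mvfderiv_metric (he i).self (he k).self
    have hconst : (fun y ↦ inner ℝ (e i y) (e k y)) =ᶠ[𝓝 x]
        fun _ ↦ (if i = k then 1 else 0 : ℝ) := by
      filter_upwards [hon] with y hy using orthonormal_iff_ite.1 hy i k
    rw [mvfderiv_congr hconst, mvfderiv_const, orthonormal_iff_ite.1 hon.self_of_nhds i k, real_inner_comm (e k x)] at h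
    simp only [zero_apply] at h
    simp only [hcdef]
    split_ifs at h ⊢ <;> linarith
  have hterm (i j) : mvfderiv I
      (fun y ↦ inner ℝ (riemannCurvature I (e i) (e j) (e j) y) (e i y)) x (V x) =
      ∑ k, c i k * (T k j j i + T i j j k) + ∑ k, c j k * (T i k j i + T i j k i)
        + 2 * T i j j i := by
    have hW : (inner ℝ (riemannCurvature I (e i) (e j) (e j) x) (mlieBracket I V (e i) x) : ℝ) =
        ∑ k, c i k * T i j j k := by
      rw [← (orthonormalBasisOf hon.self_of_nhds).sum_repr' (mlieBracket I V (e i) x)]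
      simp only [orthonormalBasisOf_apply, inner_sum, real_inner_smul_right, hcdef, hT]
    rw [hV.mvfderiv_metric (hRm i j).self (he i).self,
      hV.mlieBracket_riemannCurvature (he i) (he j) (he j),
      riemannCurvature_expand_left he hon (hVe i) (he j) (he j),
      riemannCurvature_expand_middle he hon (he i) (hVe j) (he j),
      riemannCurvature_expand_right he hon (he i) (he j) (hVe j), hW]
    simp only [inner_add_left, sum_inner, real_inner_smul_left, mul_add, Finset.sum_add_distrib,
      hcdef, hT]
    ring
  have hin (i) := mvfderiv_finset_sum Finset.univ fun j _ ↦ hd i j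
  rw [mvfderiv_congr hR, (mvfderiv_finset_sum Finset.univ fun i _ ↦ (hin i).2).1,
    hR.self_of_nhds]
  simp only [fun i ↦ (hin i).1, sum_apply, hterm, Finset.sum_add_distrib]
  have s1 : ∑ i, ∑ j, ∑ k, c i k * (T k j j i + T i j j k) = -2 * ∑ i, ∑ j, T i j j i := by
    rw [← sum_mul_add_swap (A := fun k i ↦ ∑ j, T k j j i) hc]
    refine Finset.sum_congr rfl fun i _ ↦ ?_
    rw [Finset.sum_comm]
    refine Finset.sum_congr rfl fun k _ ↦ ?_
    rw [← Finset.sum_add_distrib, Finset.mul_sum]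
  have s2 : ∑ i, ∑ j, ∑ k, c j k * (T i k j i + T i j k i) = -2 * ∑ i, ∑ j, T i j j i := by
    rw [Finset.sum_comm (f := fun i j ↦ T i j j i),
      ← sum_mul_add_swap (A := fun k j ↦ ∑ i, T i k j i) hc, Finset.sum_comm]
    refine Finset.sum_congr rfl fun j _ ↦ ?_
    rw [Finset.sum_comm]
    refine Finset.sum_congr rfl fun k _ ↦ ?_
    rw [← Finset.sum_add_distrib, Finset.mul_sum]
  rw [s1, s2]
  simp only [← Finset.mul_sum, hT]
  ring

end Homothety

section Coordinates

variable {E : Type*} [NormedAddCommGroup E] [NormedSpace ℝ E] [FiniteDimensional ℝ E]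
  {H : Type*} [TopologicalSpace H] {I : ModelWithCorners ℝ E H}
  {M : Type*} [TopologicalSpace M] [ChartedSpace H M] [IsManifold I ∞ M]
  {X X' Y Y' Z Z' V W : Π x : M, TangentSpace I x} {x : M}
  {A B : Type*} [NormedAddCommGroup A] [NormedSpace ℝ A] [NormedAddCommGroup B] [NormedSpace ℝ B]

lemma mvfderiv_clm_comp (ℓ : A →L[ℝ] B) {h : M → A} (hh : MDiffAt h x) (u : TangentSpace I x) :
    mvfderiv I (fun y ↦ ℓ (h y)) x u = ℓ (mvfderiv I h x u) := by
  have h1 : mfderiv I 𝓘(ℝ, B) (ℓ ∘ h) x = (mfderiv 𝓘(ℝ, A) 𝓘(ℝ, B) ℓ (h x)).comp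
      (mfderiv I 𝓘(ℝ, A) h x) := mfderiv_comp x ℓ.mdifferentiableAt hh
  rw [ContinuousLinearMap.mfderiv_eq] at h1
  exact congrArg (fun L ↦ L u) h1

lemma eq_of_forall_clm [FiniteDimensional ℝ A] {a b : A} (h : ∀ ℓ : A →L[ℝ] ℝ, ℓ a = ℓ b) :
    a = b := by
  have e := Module.finBasis ℝ A
  exact e.ext_elem fun i ↦ h (LinearMap.toContinuousLinearMap (e.coord i))

lemma contMDiffAt_of_forall_clm [FiniteDimensional ℝ A] {h : M → A}
    (hh : ∀ ℓ : A →L[ℝ] ℝ, ContMDiffAt I 𝓘(ℝ, ℝ) ∞ (fun y ↦ ℓ (h y)) x) :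
    ContMDiffAt I 𝓘(ℝ, A) ∞ h x := by
  let e := (Module.finBasis ℝ A).equivFunL
  have h1 : ContMDiffAt I 𝓘(ℝ, Fin (Module.finrank ℝ A) → ℝ) ∞ (fun y ↦ e (h y)) x :=
    contMDiffAt_pi_space.2 fun i ↦
      hh ((ContinuousLinearMap.proj i).comp (e : A →L[ℝ] Fin (Module.finrank ℝ A) → ℝ))
  have h2 := (e.symm : (Fin (Module.finrank ℝ A) → ℝ) →L[ℝ] A).contMDiff.contMDiffAt.comp x h1
  refine h2.congr_of_eventuallyEq (Eventually.of_forall fun y ↦ ?_)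
  exact (e.symm_apply_apply (h y)).symm

section Commutator

variable [RiemannianBundle (fun x : M ↦ TangentSpace I x)]
  [IsContMDiffRiemannianBundle I ∞ E (fun x : M ↦ TangentSpace I x)]
  [FiniteDimensional ℝ A] {ψ : M → A}

lemma smoothFunNear_clm_comp (hψ : ∀ᶠ y in 𝓝 x, ContMDiffAt I 𝓘(ℝ, A) ∞ ψ y) (ℓ : A →L[ℝ] ℝ) :
    SmoothFunNear I (fun y ↦ ℓ (ψ y)) x := by
  filter_upwards [hψ] with y hy
  exact (ContinuousLinearMap.contMDiffAt ℓ).comp y hy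

lemma mvfderiv_clm_comp_eventuallyEq (hψ : ∀ᶠ y in 𝓝 x, ContMDiffAt I 𝓘(ℝ, A) ∞ ψ y)
    (X : Π x : M, TangentSpace I x) (ℓ : A →L[ℝ] ℝ) :
    (fun y ↦ ℓ (mvfderiv I ψ y (X y))) =ᶠ[𝓝 x]
      fun y ↦ mvfderiv I (fun z ↦ ℓ (ψ z)) y (X y) := by
  filter_upwards [hψ] with y hy
  rw [mvfderiv_clm_comp ℓ (hy.mdifferentiableAt (by simp))]

lemma contMDiffAt_mvfderiv (hψ : ∀ᶠ y in 𝓝 x, ContMDiffAt I 𝓘(ℝ, A) ∞ ψ y)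
    (hX : SmoothFieldNear I X x) :
    ContMDiffAt I 𝓘(ℝ, A) ∞ (fun y ↦ mvfderiv I ψ y (X y)) x :=
  contMDiffAt_of_forall_clm fun ℓ ↦ (((smoothFunNear_clm_comp hψ ℓ).derivAlong hX).congr
    (mvfderiv_clm_comp_eventuallyEq hψ X ℓ)).self

/-- The Lie bracket acts as the commutator of derivations on vector-valued functions. -/
lemma mvfderiv_commutator (hψ : ∀ᶠ y in 𝓝 x, ContMDiffAt I 𝓘(ℝ, A) ∞ ψ y)
    (hX : SmoothFieldNear I X x) (hY : SmoothFieldNear I Y x) :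
    mvfderiv I (fun y ↦ mvfderiv I ψ y (Y y)) x (X x)
      - mvfderiv I (fun y ↦ mvfderiv I ψ y (X y)) x (Y x)
      = mvfderiv I ψ x (mlieBracket I X Y x) := by
  refine eq_of_forall_clm fun ℓ ↦ ?_
  rw [map_sub, ← mvfderiv_clm_comp ℓ ((contMDiffAt_mvfderiv hψ hY).mdifferentiableAt (by simp)),
    ← mvfderiv_clm_comp ℓ ((contMDiffAt_mvfderiv hψ hX).mdifferentiableAt (by simp)),
    mvfderiv_congr (mvfderiv_clm_comp_eventuallyEq hψ X ℓ),
    mvfderiv_congr (mvfderiv_clm_comp_eventuallyEq hψ Y ℓ),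
    ← mvfderiv_clm_comp ℓ (hψ.self_of_nhds.mdifferentiableAt (by simp)),
    mvfderiv_mvfderiv_sub (smoothFunNear_clm_comp hψ ℓ) hX hY]

end Commutator

/-- The coordinates, in the trivialization of the tangent bundle at `p`, of a tangent vector. -/
def vectorCoord (I : ModelWithCorners ℝ E H) [IsManifold I ∞ M] (p : M) {y : M}
    (w : TangentSpace I y) : E :=
  (trivializationAt E (TangentSpace I : M → Type _) p (TotalSpace.mk' E y w)).2

lemma eventually_mem_baseSet (p : M) :
    ∀ᶠ y in 𝓝 p, y ∈ (trivializationAt E (TangentSpace I : M → Type _) p).baseSet :=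
  (trivializationAt E (TangentSpace I : M → Type _) p).open_baseSet.mem_nhds
    (FiberBundle.mem_baseSet_trivializationAt' p)

lemma symm_vectorCoord {p y : M}
    (hy : y ∈ (trivializationAt E (TangentSpace I : M → Type _) p).baseSet)
    (w : TangentSpace I y) :
    (trivializationAt E (TangentSpace I : M → Type _) p).symm y (vectorCoord I p w) = w :=
  (trivializationAt E (TangentSpace I : M → Type _) p).symm_apply_apply_mk hy w

lemma vectorCoord_symm {p y : M}
    (hy : y ∈ (trivializationAt E (TangentSpace I : M → Type _) p).baseSet) (a : E) :
    vectorCoord I p ((trivializationAt E (TangentSpace I : M → Type _) p).symm y a) = a :=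
  congrArg Prod.snd ((trivializationAt E (TangentSpace I : M → Type _) p).apply_mk_symm hy a)

lemma vectorCoord_eq_linearMapAt {p y : M}
    (hy : y ∈ (trivializationAt E (TangentSpace I : M → Type _) p).baseSet)
    (w : TangentSpace I y) :
    vectorCoord I p w = (trivializationAt E (TangentSpace I : M → Type _) p).linearMapAt ℝ y w :=
  (congrFun ((trivializationAt E (TangentSpace I : M → Type _) p).coe_linearMapAt_of_mem
    (R := ℝ) hy) w).symm

lemma vectorCoord_eq_mvfderiv {p y : M}
    (hy : y ∈ (trivializationAt E (TangentSpace I : M → Type _) p).baseSet)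
    (w : TangentSpace I y) :
    vectorCoord I p w = mvfderiv I (extChartAt I p) y w := by
  have h := TangentBundle.continuousLinearMapAt_trivializationAt (I := I) (x₀ := p) (x := y) hy
  exact (vectorCoord_eq_linearMapAt hy w).trans (congrArg (fun L ↦ L w) h)

lemma vectorCoord_add {p y : M}
    (hy : y ∈ (trivializationAt E (TangentSpace I : M → Type _) p).baseSet)
    (u w : TangentSpace I y) :
    vectorCoord I p (u + w) = vectorCoord I p u + vectorCoord I p w := by
  simp only [vectorCoord_eq_linearMapAt hy, map_add]

lemma vectorCoord_smul {p y : M}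
    (hy : y ∈ (trivializationAt E (TangentSpace I : M → Type _) p).baseSet)
    (c : ℝ) (w : TangentSpace I y) :
    vectorCoord I p (c • w) = c • vectorCoord I p w := by
  simp only [vectorCoord_eq_linearMapAt hy, map_smul]

lemma vectorCoord_extendVector (u : TangentSpace I x) :
    (fun y ↦ vectorCoord I x (extendVector I u y)) =ᶠ[𝓝 x] fun _ ↦ vectorCoord I x u := by
  filter_upwards [eventually_mem_baseSet (I := I) x] with y hy using vectorCoord_symm hy _

lemma eq_of_vectorCoord_eq {p y : M}
    (hy : y ∈ (trivializationAt E (TangentSpace I : M → Type _) p).baseSet)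
    {u w : TangentSpace I y} (h : vectorCoord I p u = vectorCoord I p w) : u = w := by
  rw [← symm_vectorCoord hy u, h, symm_vectorCoord hy w]

lemma extendVector_add (u w : TangentSpace I x) :
    extendVector I (u + w) =ᶠ[𝓝 x] extendVector I u + extendVector I w := by
  filter_upwards [eventually_mem_baseSet (I := I) x, vectorCoord_extendVector u,
    vectorCoord_extendVector w, vectorCoord_extendVector (u + w)] with y hy h1 h2 h3
  refine eq_of_vectorCoord_eq hy ?_
  rw [h3, Pi.add_apply, vectorCoord_add hy, h1, h2,
    vectorCoord_add (FiberBundle.mem_baseSet_trivializationAt' x)]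

lemma extendVector_smul (c : ℝ) (u : TangentSpace I x) :
    extendVector I (c • u) =ᶠ[𝓝 x] (fun _ : M ↦ c) • extendVector I u := by
  filter_upwards [eventually_mem_baseSet (I := I) x, vectorCoord_extendVector u,
    vectorCoord_extendVector (c • u)] with y hy h1 h3
  refine eq_of_vectorCoord_eq hy ?_
  rw [h3, Pi.smul_apply', vectorCoord_smul hy, h1,
    vectorCoord_smul (FiberBundle.mem_baseSet_trivializationAt' x)]

lemma eventually_contMDiffAt_extChartAt (p : M) :
    ∀ᶠ y in 𝓝 p, ContMDiffAt I 𝓘(ℝ, E) ∞ (extChartAt I p) y := by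
  filter_upwards [(chartAt H p).open_source.mem_nhds (mem_chart_source H p)] with y hy
    using contMDiffAt_extChartAt' hy

lemma mdifferentiableAt_vectorCoord (hX : MDiffAt (T% X) x) :
    MDiffAt (fun y ↦ vectorCoord I x (X y)) x :=
  ((trivializationAt E (TangentSpace I : M → Type _) x).mdifferentiableAt_section_iff I X
    (FiberBundle.mem_baseSet_trivializationAt' x)).1 hX

section Riemannian

variable [RiemannianBundle (fun x : M ↦ TangentSpace I x)]
  [IsContMDiffRiemannianBundle I ∞ E (fun x : M ↦ TangentSpace I x)]

lemma mlieBracket_extendVector (u w : TangentSpace I x) :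
    mlieBracket I (extendVector I u) (extendVector I w) x = 0 := by
  have hx : x ∈ (trivializationAt E (TangentSpace I : M → Type _) x).baseSet :=
    FiberBundle.mem_baseSet_trivializationAt' x
  have hc (w : TangentSpace I x) :
      (fun y ↦ mvfderiv I (extChartAt I x) y (extendVector I w y)) =ᶠ[𝓝 x]
        fun _ ↦ vectorCoord I x w := by
    filter_upwards [eventually_mem_baseSet (I := I) x, vectorCoord_extendVector w] with y hy h
    rw [← vectorCoord_eq_mvfderiv hy, h]
  have h := mvfderiv_commutator (eventually_contMDiffAt_extChartAt x)
    (smoothFieldNear_extendVector u) (smoothFieldNear_extendVector w)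
  rw [mvfderiv_congr (hc u), mvfderiv_congr (hc w), mvfderiv_const, mvfderiv_const,
    ← vectorCoord_eq_mvfderiv hx] at h
  refine eq_of_vectorCoord_eq hx ?_
  rw [← h, vectorCoord_eq_linearMapAt hx, map_zero]
  simp

/-- The Levi-Civita connection in the coordinates of the preferred chart at `x`. -/
lemma leviCivita_eq_coord (hX : MDiffAt (T% X) x) (hW : MDiffAt (T% W) x) :
    leviCivita I X W x =
      (trivializationAt E (TangentSpace I : M → Type _) x).symm x
        (mvfderiv I (fun y ↦ vectorCoord I x (W y)) x (X x))
      + leviCivita I X (extendVector I (W x)) x := by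
  have hx : x ∈ (trivializationAt E (TangentSpace I : M → Type _) x).baseSet :=
    FiberBundle.mem_baseSet_trivializationAt' x
  have ht : TensorialAt I E (fun W ↦ vectorCoord I x (leviCivita I X W x)
      - mvfderiv I (fun y ↦ vectorCoord I x (W y)) x (X x)) x := by
    refine ⟨fun {f W} hf hW ↦ ?_, fun {W W'} hW hW' ↦ ?_⟩
    · have h : (fun y ↦ vectorCoord I x ((f • W) y)) =ᶠ[𝓝 x]
          f • fun y ↦ vectorCoord I x (W y) := by
        filter_upwards [eventually_mem_baseSet (I := I) x] with y hy
          using vectorCoord_smul hy _ _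
      rw [leviCivita_smul_right hf hX hW, mvfderiv_congr h,
        mvfderiv_smul hf (mdifferentiableAt_vectorCoord hW), vectorCoord_add hx,
        vectorCoord_smul hx, vectorCoord_smul hx, smul_sub]
      simp only [add_apply, smul_apply, ContinuousLinearMap.smulRight_apply]
      abel
    · have h : (fun y ↦ vectorCoord I x ((W + W') y)) =ᶠ[𝓝 x]
          (fun y ↦ vectorCoord I x (W y)) + fun y ↦ vectorCoord I x (W' y) := by
        filter_upwards [eventually_mem_baseSet (I := I) x] with y hy
          using vectorCoord_add hy _ _
      rw [leviCivita_add_right hX hW hW', mvfderiv_congr h,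
        mvfderiv_add (mdifferentiableAt_vectorCoord hW) (mdifferentiableAt_vectorCoord hW'),
        vectorCoord_add hx]
      simp only [add_apply]
      abel
  have h := ht.pointwise hW (smoothFieldNear_extendVector (W x)).mdifferentiableAt
    (extendVector_self _).symm
  rw [mvfderiv_congr (vectorCoord_extendVector (W x)), mvfderiv_const] at h
  refine eq_of_vectorCoord_eq hx ?_
  rw [vectorCoord_add hx, vectorCoord_symm hx, add_comm, ← sub_eq_iff_eq_add, h]
  simp

/-- The map `w ↦ ∇_X W`, for `W` the field through `w` with constant coordinates. -/
def christoffel {x : M} {X : Π x : M, TangentSpace I x} (hX : MDiffAt (T% X) x) :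
    TangentSpace I x →ₗ[ℝ] TangentSpace I x where
  toFun w := leviCivita I X (extendVector I w) x
  map_add' u w := by
    rw [leviCivita_congr (EventuallyEq.refl _ X) (extendVector_add u w),
      leviCivita_add_right hX (smoothFieldNear_extendVector u).mdifferentiableAt
        (smoothFieldNear_extendVector w).mdifferentiableAt]
  map_smul' c w := by
    rw [leviCivita_congr (EventuallyEq.refl _ X) (extendVector_smul c w),
      leviCivita_smul_right mdifferentiableAt_const hX
        (smoothFieldNear_extendVector w).mdifferentiableAt, mvfderiv_const]
    simp

end Riemannian

end Coordinates

section Along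

variable {E : Type*} [NormedAddCommGroup E] [NormedSpace ℝ E] [FiniteDimensional ℝ E]
  {H : Type*} [TopologicalSpace H] {I : ModelWithCorners ℝ E H}
  {M : Type*} [TopologicalSpace M] [ChartedSpace H M] [IsManifold I ∞ M]
  [RiemannianBundle (fun x : M ↦ TangentSpace I x)]
  [IsContMDiffRiemannianBundle I ∞ E (fun x : M ↦ TangentSpace I x)]
  {F : Type*} [NormedAddCommGroup F] [NormedSpace ℝ F] [FiniteDimensional ℝ F]
  {G : Type*} [TopologicalSpace G] {J : ModelWithCorners ℝ F G}
  {N : Type*} [TopologicalSpace N] [ChartedSpace G N] [IsManifold J ∞ N]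
  [RiemannianBundle (fun y : N ↦ TangentSpace J y)]
  [IsContMDiffRiemannianBundle J ∞ F (fun y : N ↦ TangentSpace J y)]
  {ι : M → N} {X Y Z V : Π x : M, TangentSpace I x} {x : M}

lemma mdifferentiableAt_extendVector {p : N} (u : TangentSpace J p) :
    MDiffAt (T% (extendVector J u)) p :=
  (smoothFieldNear_extendVector u).mdifferentiableAt

lemma mvfderiv_comp_apply' {A : Type*} [NormedAddCommGroup A] [NormedSpace ℝ A] {g : N → A}
    (hg : MDiffAt g (ι x)) (hι : MDiffAt ι x) (u : TangentSpace I x) :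
    mvfderiv I (fun y ↦ g (ι y)) x u = mvfderiv J g (ι x) (mfderiv I J ι x u) :=
  congrArg (fun L ↦ L u) (mfderiv_comp x hg hι)

lemma covDerivAlong_eq (W : Π x : M, TangentSpace J (ι x)) :
    covDerivAlong I J ι X W x =
      (trivializationAt F (TangentSpace J : N → Type _) (ι x)).symm (ι x)
        (mvfderiv I (fun y ↦ vectorCoord J (ι x) (W y)) x (X x))
      + christoffel (mdifferentiableAt_extendVector (mfderiv I J ι x (X x))) (W x) := rfl

/-- The covariant derivative of a vector field restricted along `ι`. -/
lemma covDerivAlong_comp (hι : MDiffAt ι x) {v : Π y : N, TangentSpace J y}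
    (hv : MDiffAt (T% v) (ι x)) :
    covDerivAlong I J ι X (fun y ↦ v (ι y)) x =
      leviCivita J (extendVector J (mfderiv I J ι x (X x))) v (ι x) := by
  rw [leviCivita_eq_coord (mdifferentiableAt_extendVector _) hv, extendVector_self,
    ← mvfderiv_comp_apply' (mdifferentiableAt_vectorCoord hv) hι]
  rfl

lemma symm_eq_sum (p : N) (c : F) :
    (trivializationAt F (TangentSpace J : N → Type _) p).symm p c =
      ∑ a, (Module.finBasis ℝ F).coord a c •
        (trivializationAt F (TangentSpace J : N → Type _) p).symm p (Module.finBasis ℝ F a) := by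
  have hp : p ∈ (trivializationAt F (TangentSpace J : N → Type _) p).baseSet :=
    FiberBundle.mem_baseSet_trivializationAt' p
  refine eq_of_vectorCoord_eq hp ?_
  rw [vectorCoord_symm hp, vectorCoord_eq_linearMapAt hp, map_sum]
  simp only [← vectorCoord_eq_linearMapAt hp, vectorCoord_smul hp, vectorCoord_symm hp]
  exact ((Module.finBasis ℝ F).sum_repr c).symm

lemma eq_sum_extendVector {p q : N}
    (hq : q ∈ (trivializationAt F (TangentSpace J : N → Type _) p).baseSet)
    (w : TangentSpace J q) :
    w = ∑ a, (Module.finBasis ℝ F).coord a (vectorCoord J p w) •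
      extendVector J ((trivializationAt F (TangentSpace J : N → Type _) p).symm p
        (Module.finBasis ℝ F a)) q := by
  have hp : p ∈ (trivializationAt F (TangentSpace J : N → Type _) p).baseSet :=
    FiberBundle.mem_baseSet_trivializationAt' p
  have h (a) : vectorCoord J p (extendVector J ((trivializationAt F
      (TangentSpace J : N → Type _) p).symm p (Module.finBasis ℝ F a)) q) =
      Module.finBasis ℝ F a :=
    (vectorCoord_symm hq _).trans (vectorCoord_symm hp _)
  refine eq_of_vectorCoord_eq hq ?_
  rw [vectorCoord_eq_linearMapAt hq (∑ a, _), map_sum]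
  simp only [← vectorCoord_eq_linearMapAt hq, vectorCoord_smul hq, h]
  exact ((Module.finBasis ℝ F).sum_repr _).symm

lemma inner_sum_smul_sum_smul {κ V : Type*} [NormedAddCommGroup V] [InnerProductSpace ℝ V]
    [Fintype κ] (c d : κ → ℝ) (u w : κ → V) :
    (inner ℝ (∑ a, c a • u a) (∑ b, d b • w b) : ℝ) =
      ∑ a, ∑ b, c a * (d b * inner ℝ (u a) (w b)) := by
  simp only [sum_inner, inner_sum, real_inner_smul_left, real_inner_smul_right]
  rw [Finset.sum_comm]
  exact Finset.sum_congr rfl fun a _ ↦ Finset.sum_congr rfl fun b _ ↦ by ring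

/-- The covariant derivative along `ι` is compatible with the metric. -/
lemma mvfderiv_inner_along (hι : MDiffAt ι x) {W₁ W₂ : Π x : M, TangentSpace J (ι x)}
    (h₁ : MDiffAt (fun y ↦ vectorCoord J (ι x) (W₁ y)) x)
    (h₂ : MDiffAt (fun y ↦ vectorCoord J (ι x) (W₂ y)) x) :
    mvfderiv I (fun y ↦ inner ℝ (W₁ y) (W₂ y)) x (X x) =
      inner ℝ (covDerivAlong I J ι X W₁ x) (W₂ x)
        + inner ℝ (W₁ x) (covDerivAlong I J ι X W₂ x) := by
  have hp : ι x ∈ (trivializationAt F (TangentSpace J : N → Type _) (ι x)).baseSet :=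
    FiberBundle.mem_baseSet_trivializationAt' (ι x)
  set b := Module.finBasis ℝ F with hb
  set ε : Fin (Module.finrank ℝ F) → TangentSpace J (ι x) := fun a ↦
    (trivializationAt F (TangentSpace J : N → Type _) (ι x)).symm (ι x) (b a) with hε
  set Γ := christoffel (mdifferentiableAt_extendVector (mfderiv I J ι x (X x))) with hΓ
  let L : Fin (Module.finrank ℝ F) → F →L[ℝ] ℝ := fun a ↦
    LinearMap.toContinuousLinearMap (b.coord a)
  let α : Fin (Module.finrank ℝ F) → M → ℝ := fun a y ↦ L a (vectorCoord J (ι x) (W₁ y))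
  let β : Fin (Module.finrank ℝ F) → M → ℝ := fun a y ↦ L a (vectorCoord J (ι x) (W₂ y))
  let g : Fin (Module.finrank ℝ F) → Fin (Module.finrank ℝ F) → M → ℝ := fun a c y ↦
    inner ℝ (extendVector J (ε a) (ι y)) (extendVector J (ε c) (ι y))
  have hα (a) : MDiffAt (α a) x := (L a).mdifferentiableAt.comp x h₁
  have hβ (a) : MDiffAt (β a) x := (L a).mdifferentiableAt.comp x h₂
  have hgN (a c) : MDiffAt (fun z ↦ inner ℝ (extendVector J (ε a) z) (extendVector J (ε c) z))
      (ι x) := mdifferentiableAt_metric (mdifferentiableAt_extendVector _)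
        (mdifferentiableAt_extendVector _)
  have hg (a c) : MDiffAt (g a c) x := (hgN a c).comp x hι
  have hdg (a c) : mvfderiv I (g a c) x (X x) =
      inner ℝ (Γ (ε a)) (ε c) + inner ℝ (ε a) (Γ (ε c)) := by
    have h := mvfderiv_inner (mdifferentiableAt_extendVector (mfderiv I J ι x (X x)))
      (mdifferentiableAt_extendVector (ε a)) (mdifferentiableAt_extendVector (ε c))
    rw [extendVector_self, extendVector_self, extendVector_self] at h
    exact (mvfderiv_comp_apply' (hgN a c) hι (X x)).trans h
  have hdα (a) : mvfderiv I (α a) x (X x) =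
      L a (mvfderiv I (fun y ↦ vectorCoord J (ι x) (W₁ y)) x (X x)) := mvfderiv_clm_comp _ h₁ _
  have hdβ (a) : mvfderiv I (β a) x (X x) =
      L a (mvfderiv I (fun y ↦ vectorCoord J (ι x) (W₂ y)) x (X x)) := mvfderiv_clm_comp _ h₂ _
  have hexp : (fun y ↦ (inner ℝ (W₁ y) (W₂ y) : ℝ)) =ᶠ[𝓝 x]
      fun y ↦ ∑ a, ∑ c, (α a * (β c * g a c)) y := by
    filter_upwards [hι.continuousAt.eventually (eventually_mem_baseSet (I := J) (ι x))] with y hy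
    conv_lhs => rw [eq_sum_extendVector hy (W₁ y), eq_sum_extendVector hy (W₂ y),
      inner_sum_smul_sum_smul]
    rfl
  have hterm (a c) : mvfderiv I (α a * (β c * g a c)) x (X x) =
      mvfderiv I (α a) x (X x) * (β c x * inner ℝ (ε a) (ε c))
      + α a x * (mvfderiv I (β c) x (X x) * inner ℝ (ε a) (ε c))
      + (α a x * (β c x * inner ℝ (Γ (ε a)) (ε c))
        + α a x * (β c x * inner ℝ (ε a) (Γ (ε c)))) := by
    have hgx : g a c x = inner ℝ (ε a) (ε c) := by
      simp only [g, extendVector_self]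
    rw [mvfderiv_mul (hα a) ((hβ c).mul (hg a c)), mvfderiv_mul (hβ c) (hg a c)]
    simp only [add_apply, smul_apply, smul_eq_mul, Pi.mul_apply, hdg, hgx]
    ring
  have hin (a) := mvfderiv_finset_sum Finset.univ (I := I) (x := x)
    (f := fun c ↦ α a * (β c * g a c)) fun c _ ↦ (hα a).mul ((hβ c).mul (hg a c))
  have hW₁ : W₁ x = ∑ a, α a x • ε a := by
    conv_lhs => rw [eq_sum_extendVector hp (W₁ x)]
    simp only [extendVector_self]
    rfl
  have hW₂ : W₂ x = ∑ a, β a x • ε a := by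
    conv_lhs => rw [eq_sum_extendVector hp (W₂ x)]
    simp only [extendVector_self]
    rfl
  have hD₁ : covDerivAlong I J ι X W₁ x =
      ∑ a, mvfderiv I (α a) x (X x) • ε a + ∑ a, α a x • Γ (ε a) := by
    rw [covDerivAlong_eq, symm_eq_sum, hW₁, ← hΓ, map_sum]
    simp only [map_smul, hdα]
    rfl
  have hD₂ : covDerivAlong I J ι X W₂ x =
      ∑ a, mvfderiv I (β a) x (X x) • ε a + ∑ a, β a x • Γ (ε a) := by
    rw [covDerivAlong_eq, symm_eq_sum, hW₂, ← hΓ, map_sum]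
    simp only [map_smul, hdβ]
    rfl
  rw [mvfderiv_congr hexp, (mvfderiv_finset_sum Finset.univ fun a _ ↦ (hin a).2).1, hD₁, hD₂,
    hW₁, hW₂, inner_add_left, inner_add_right]
  simp only [inner_sum_smul_sum_smul, fun a ↦ (hin a).1, sum_apply, hterm, Finset.sum_add_distrib]
  ring

lemma eventually_contMDiffAt_extChartAt_comp (hι : ContMDiff I J ∞ ι) (x : M) :
    ∀ᶠ y in 𝓝 x, ContMDiffAt I 𝓘(ℝ, F) ∞ (fun y ↦ extChartAt J (ι x) (ι y)) y := by
  filter_upwards [hι.continuous.continuousAt.eventually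
    (eventually_contMDiffAt_extChartAt (I := J) (ι x))] with y hy
  exact hy.comp y hι.contMDiffAt

lemma vectorCoord_mfderiv (hι : ContMDiff I J ∞ ι) (Z : Π x : M, TangentSpace I x) (x : M) :
    (fun y ↦ vectorCoord J (ι x) (mfderiv I J ι y (Z y))) =ᶠ[𝓝 x]
      fun y ↦ mvfderiv I (fun y ↦ extChartAt J (ι x) (ι y)) y (Z y) := by
  filter_upwards [hι.continuous.continuousAt.eventually (eventually_mem_baseSet (I := J) (ι x)),
    hι.continuous.continuousAt.eventually
      (eventually_contMDiffAt_extChartAt (I := J) (ι x))] with y hy hy'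
  rw [vectorCoord_eq_mvfderiv hy, mvfderiv_comp_apply' (hy'.mdifferentiableAt (by simp))
    (hι.contMDiffAt.mdifferentiableAt (by simp))]

lemma mdifferentiableAt_vectorCoord_mfderiv (hι : ContMDiff I J ∞ ι)
    (hZ : SmoothFieldNear I Z x) :
    MDiffAt (fun y ↦ vectorCoord J (ι x) (mfderiv I J ι y (Z y))) x :=
  ((contMDiffAt_mvfderiv (eventually_contMDiffAt_extChartAt_comp hι x) hZ).congr_of_eventuallyEq
    (vectorCoord_mfderiv hι Z x)).mdifferentiableAt (by simp)

/-- The covariant derivative along `ι` is torsion-free. -/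
lemma covDerivAlong_sub_covDerivAlong (hι : ContMDiff I J ∞ ι) (hX : SmoothFieldNear I X x)
    (hZ : SmoothFieldNear I Z x) :
    covDerivAlong I J ι X (fun y ↦ mfderiv I J ι y (Z y)) x
      - covDerivAlong I J ι Z (fun y ↦ mfderiv I J ι y (X y)) x
      = mfderiv I J ι x (mlieBracket I X Z x) := by
  have hp : ι x ∈ (trivializationAt F (TangentSpace J : N → Type _) (ι x)).baseSet :=
    FiberBundle.mem_baseSet_trivializationAt' (ι x)
  have hψ := eventually_contMDiffAt_extChartAt_comp hι x
  have hc := mvfderiv_commutator hψ hX hZ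
  have htor := leviCivita_sub_leviCivita
    (mdifferentiableAt_extendVector (mfderiv I J ι x (X x)))
    (mdifferentiableAt_extendVector (mfderiv I J ι x (Z x)))
  rw [mlieBracket_extendVector, sub_eq_zero] at htor
  have hb : vectorCoord J (ι x) (mfderiv I J ι x (mlieBracket I X Z x)) =
      mvfderiv I (fun y ↦ extChartAt J (ι x) (ι y)) x (mlieBracket I X Z x) :=
    (vectorCoord_mfderiv hι (mlieBracket I X Z) x).self_of_nhds
  refine eq_of_vectorCoord_eq hp ?_
  rw [hb, ← hc]
  unfold covDerivAlong
  rw [htor, add_sub_add_right_eq_sub]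
  have h1 := mvfderiv_congr (I := I) (vectorCoord_mfderiv hι Z x)
  have h2 := mvfderiv_congr (I := I) (vectorCoord_mfderiv hι X x)
  rw [← h1, ← h2, vectorCoord_eq_linearMapAt hp, map_sub, ← vectorCoord_eq_linearMapAt hp,
    ← vectorCoord_eq_linearMapAt hp, vectorCoord_symm hp, vectorCoord_symm hp]
  rfl

end Along

section Submanifold

variable {E : Type*} [NormedAddCommGroup E] [NormedSpace ℝ E] [FiniteDimensional ℝ E]
  {H : Type*} [TopologicalSpace H] {I : ModelWithCorners ℝ E H}
  {M : Type*} [TopologicalSpace M] [ChartedSpace H M] [IsManifold I ∞ M]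
  [RiemannianBundle (fun x : M ↦ TangentSpace I x)]
  [IsContMDiffRiemannianBundle I ∞ E (fun x : M ↦ TangentSpace I x)]
  {F : Type*} [NormedAddCommGroup F] [NormedSpace ℝ F] [FiniteDimensional ℝ F]
  {G : Type*} [TopologicalSpace G] {J : ModelWithCorners ℝ F G}
  {N : Type*} [TopologicalSpace N] [ChartedSpace G N] [IsManifold J ∞ N]
  [RiemannianBundle (fun y : N ↦ TangentSpace J y)]
  [IsContMDiffRiemannianBundle J ∞ F (fun y : N ↦ TangentSpace J y)]
  {ι : M → N} {v : Π y : N, TangentSpace J y} {X Y : Π x : M, TangentSpace I x} {x : M} {ρ : ℝ}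

lemma inner_tangentialPart (x : M) (w : TangentSpace J (ι x)) (u : TangentSpace I x) :
    inner ℝ (tangentialPart I J ι x w) u = (inner ℝ w (mfderiv I J ι x u) : ℝ) := by
  unfold tangentialPart
  conv_rhs => rw [← (frame I x).sum_repr' u, map_sum]
  rw [sum_inner, inner_sum]
  refine Finset.sum_congr rfl fun i _ ↦ ?_
  rw [map_smul, real_inner_smul_left, real_inner_smul_right, mul_comm]

lemma inner_normalPart (x : M) (w w' : TangentSpace J (ι x)) :
    inner ℝ (normalPart I J ι x w) w' = (inner ℝ w (normalPart I J ι x w') : ℝ) := by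
  unfold normalPart
  rw [inner_sub_left, inner_sub_right, ← inner_tangentialPart,
    real_inner_comm w' (mfderiv I J ι x (tangentialPart I J ι x w)), ← inner_tangentialPart,
    real_inner_comm (tangentialPart I J ι x w)]

/-- The tangential part of a concurrent vector field is the gradient of `½ |v|²`. -/
lemma IsConcurrent.exists_isGradientOf (hv : IsConcurrent J v) (hι : ContMDiff I J ∞ ι) :
    ∃ f : M → ℝ, ContMDiff I 𝓘(ℝ, ℝ) ∞ f ∧
      IsGradientOf I (fun x ↦ tangentialPart I J ι x (v (ι x))) f := by
  have hsm : ContMDiff J 𝓘(ℝ, ℝ) ∞ (fun y ↦ (inner ℝ (v y) (v y) : ℝ)) := fun y ↦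
    SmoothFieldAt.metric (hv.smooth y) (hv.smooth y)
  refine ⟨fun x ↦ (1 / 2 : ℝ) * inner ℝ (v (ι x)) (v (ι x)),
    (contMDiff_const.mul hsm).comp hι, fun x u ↦ ?_⟩
  have hvx : MDiffAt (T% v) (ι x) := SmoothFieldAt.mdifferentiableAt (hv.smooth (ι x))
  have hex := smoothFieldNear_extendVector (I := J) (mfderiv I J ι x u)
  have h := mvfderiv_inner hex.mdifferentiableAt hvx hvx
  rw [hv.equation _ _ hex.self, extendVector_self, real_inner_comm] at h
  have hmul := mvfderiv_clm_comp (I := I) (x := x) ((1 / 2 : ℝ) • ContinuousLinearMap.id ℝ ℝ)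
    (h := fun y ↦ (inner ℝ (v (ι y)) (v (ι y)) : ℝ))
    ((hsm.comp hι).contMDiffAt.mdifferentiableAt (by simp)) u
  rw [mvfderiv_comp_apply' ((hsm (ι x)).mdifferentiableAt (by simp))
    (hι.contMDiffAt.mdifferentiableAt (by simp)), h] at hmul
  rw [inner_tangentialPart]
  refine Eq.trans ?_ hmul.symm
  simp only [smul_apply, ContinuousLinearMap.id_apply, smul_eq_mul]
  ring

/-- The Lie derivative of the metric along the tangential part of a concurrent vector field, in
terms of the second fundamental form. -/
lemma IsConcurrent.lieDerivMetric_tangentialPart (hv : IsConcurrent J v)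
    (hι : IsIsometricImmersion I J ι)
    (hV : SmoothField I (fun x ↦ tangentialPart I J ι x (v (ι x))))
    (hX : SmoothFieldNear I X x) :
    1 / 2 * lieDerivMetric I (fun x ↦ tangentialPart I J ι x (v (ι x))) X X x =
      inner ℝ (X x) (X x) + inner ℝ (v (ι x)) (secondFundamentalForm I J ι X X x) := by
  set V : Π x : M, TangentSpace I x := fun x ↦ tangentialPart I J ι x (v (ι x)) with hVdef
  have hιx : MDiffAt ι x := hι.smooth.contMDiffAt.mdifferentiableAt (by simp)
  have hvx : MDiffAt (T% v) (ι x) := SmoothFieldAt.mdifferentiableAt (hv.smooth (ι x))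
  have hVx : SmoothFieldNear I V x := hV.near
  have cX := mdifferentiableAt_vectorCoord_mfderiv hι.smooth hX
  have cV := mdifferentiableAt_vectorCoord_mfderiv hι.smooth hVx
  have cv : MDiffAt (fun y ↦ vectorCoord J (ι x) (v (ι y))) x :=
    (mdifferentiableAt_vectorCoord hvx).comp x hιx
  have hXX := mvfderiv_inner_along (X := V) hιx cX cX
  have hVX := mvfderiv_inner_along (X := X) hιx cV cX
  have hvX := mvfderiv_inner_along (X := X) hιx cv cX
  rw [covDerivAlong_comp hιx hvx, hv.equation _ _ (smoothFieldNear_extendVector _).self,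
    extendVector_self] at hvX
  have hfun : (fun y ↦ (inner ℝ (v (ι y)) (mfderiv I J ι y (X y)) : ℝ)) =
      fun y ↦ inner ℝ (mfderiv I J ι y (V y)) (mfderiv I J ι y (X y)) :=
    funext fun y ↦ by rw [hι.isometric, hVdef, inner_tangentialPart]
  have hfun' : (fun y ↦ (inner ℝ (mfderiv I J ι y (X y)) (mfderiv I J ι y (X y)) : ℝ)) =
      fun y ↦ inner ℝ (X y) (X y) := funext fun y ↦ hι.isometric _ _ _
  rw [hfun] at hvX
  rw [hfun'] at hXX
  have htor := covDerivAlong_sub_covDerivAlong hι.smooth hVx hX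
  have hbr : (inner ℝ (mlieBracket I V X x) (X x) : ℝ) =
      inner ℝ (mfderiv I J ι x (mlieBracket I V X x)) (mfderiv I J ι x (X x)) :=
    (hι.isometric _ _ _).symm
  rw [← htor, inner_sub_left] at hbr
  have hn : (inner ℝ (v (ι x)) (secondFundamentalForm I J ι X X x) : ℝ) =
      inner ℝ (v (ι x)) (covDerivAlong I J ι X (fun y ↦ mfderiv I J ι y (X y)) x)
        - inner ℝ (mfderiv I J ι x (V x))
          (covDerivAlong I J ι X (fun y ↦ mfderiv I J ι y (X y)) x) := by
    rw [secondFundamentalForm, ← inner_normalPart, normalPart, inner_sub_left]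
  unfold lieDerivMetric
  rw [real_inner_comm _ (X x)]
  rw [real_inner_comm _ (mfderiv I J ι x (X x))] at hXX
  have hiso := hι.isometric x (X x) (X x)
  linarith

/-- On a minimal submanifold, tracing the soliton equation determines the scalar curvature. -/
lemma IsYamabeSoliton.scalarCurvature_eq (hE : 1 ≤ Module.finrank ℝ E) (hv : IsConcurrent J v)
    (hι : IsIsometricImmersion I J ι) (hmin : IsMinimal I J ι)
    (hsol : IsYamabeSoliton I (fun x ↦ tangentialPart I J ι x (v (ι x))) ρ) (x : M) :
    scalarCurvature I x = ρ + 1 := by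
  have hE' : (Module.finrank ℝ E : ℝ) ≠ 0 := by exact_mod_cast (by lia : Module.finrank ℝ E ≠ 0)
  have htr := (smul_eq_zero.1 (hmin x)).resolve_left (one_div_ne_zero hE')
  have hi (i) : scalarCurvature I x - ρ = 1 + inner ℝ (v (ι x)) (secondFundamentalForm I J ι
      (extendVector I (frame I x i)) (extendVector I (frame I x i)) x) := by
    have hs := smoothFieldNear_extendVector (I := I) (frame I x i)
    have h := hsol.equation x _ _ hs.self hs.self
    rw [hv.lieDerivMetric_tangentialPart hι hsol.smooth hs, extendVector_self,
      real_inner_self_eq_norm_sq, (frame I x).norm_eq_one] at h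
    linarith
  have hsum := Finset.sum_congr (rfl : Finset.univ = Finset.univ) fun i _ ↦ hi i
  rw [Finset.sum_add_distrib, ← inner_sum, htr, inner_zero_right, Finset.sum_const,
    Finset.sum_const, Finset.card_univ, Fintype.card_fin, add_zero, nsmul_eq_mul,
    nsmul_eq_mul] at hsum
  have := mul_left_cancel₀ hE' hsum
  linarith

end Submanifold

end YamabeSoliton

end

theorem corollary4p5 {n m : ℕ} (hn : 1 ≤ n)
    {M : Type*} [TopologicalSpace M] [T2Space M] [Nonempty M]
    [ChartedSpace (EuclideanSpace ℝ (Fin n)) M] [IsManifold (𝓡 n) ∞ M]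
    [RiemannianBundle (fun x : M ↦ TangentSpace (𝓡 n) x)]
    [IsContMDiffRiemannianBundle (𝓡 n) ∞ (EuclideanSpace ℝ (Fin n))
      (fun x : M ↦ TangentSpace (𝓡 n) x)]
    {N : Type*} [TopologicalSpace N] [T2Space N]
    [ChartedSpace (EuclideanSpace ℝ (Fin m)) N] [IsManifold (𝓡 m) ∞ N]
    [RiemannianBundle (fun y : N ↦ TangentSpace (𝓡 m) y)]
    [IsContMDiffRiemannianBundle (𝓡 m) ∞ (EuclideanSpace ℝ (Fin m))
      (fun y : N ↦ TangentSpace (𝓡 m) y)]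
    (v : Π y : N, TangentSpace (𝓡 m) y) (hv : YamabeSoliton.IsConcurrent (𝓡 m) v)
    (ι : M → N) (hι : YamabeSoliton.IsIsometricImmersion (𝓡 n) (𝓡 m) ι)
    (hmin : YamabeSoliton.IsMinimal (𝓡 n) (𝓡 m) ι)
    (ρ : ℝ)
    (hsol : YamabeSoliton.IsYamabeSoliton (𝓡 n)
      (fun x ↦ YamabeSoliton.tangentialPart (𝓡 n) (𝓡 m) ι x (v (ι x))) ρ) :
    YamabeSoliton.IsGradientExpandingYamabeSoliton (𝓡 n)
      (fun x ↦ YamabeSoliton.tangentialPart (𝓡 n) (𝓡 m) ι x (v (ι x))) ρ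
    ∧ (∀ x : M, YamabeSoliton.scalarCurvature (𝓡 n) x = 0)
    ∧ ρ = -1 := by

  have hR := hsol.scalarCurvature_eq (by simpa using hn) hv hι hmin
  have hhom : YamabeSoliton.IsHomothetic (𝓡 n)
      (fun x ↦ YamabeSoliton.tangentialPart (𝓡 n) (𝓡 m) ι x (v (ι x))) :=
    ⟨hsol.smooth, fun {x X Y} hX hY ↦ by
      have h := hsol.equation x X Y hX hY
      rw [hR x] at h
      linarith⟩
  have hR0 (x : M) : YamabeSoliton.scalarCurvature (𝓡 n) x = 0 := by
    have h := hhom.mvfderiv_scalarCurvature x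
    rw [show YamabeSoliton.scalarCurvature (𝓡 n) = fun _ : M ↦ ρ + 1 from funext hR,
      mvfderiv_const, zero_apply] at h
    rw [hR x]
    linarith
  have hρ : ρ = -1 := by
    obtain ⟨x⟩ := ‹Nonempty M›
    linarith [hR x, hR0 x]
  exact ⟨⟨⟨hsol, hv.exists_isGradientOf hι.smooth⟩, by linarith⟩, hR0, hρ⟩
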